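/- Let $v\in C^2([0,1];[0,\infty))$ be strictly decreasing with $v(1)=0$ and $\frac{d^2}{d\rho^2}(\rho v(\rho))<0$ on $[0,1]$. Fix $\ell>0$, $N\ge 1$, integers $n_1,\dots,n_N\ge 2$ and $T>0$. A configuration $q=(q^j_i)_{1\le j\le N,\,1\le i\le n_j}$ of real numbers is called admissible if $q^j_{i+1}-q^j_i\ge \ell$ for $1\le i<n_j$ and all $j$, and $q^j_{n_j}\le q^{j+1}_1$ for $1\le j<N$; put $$\mathcal I_q=\left]-\infty,q^1_1\right[\;\cup\;\bigcup_{j=1}^{N-1}\left]q^j_{n_j},q^{j+1}_1\right[\;\cup\;\left]q^N_{n_N},+\infty\right[.$$ Let $\bar p$ be an admissible configuration and $\bar\rho\in (L^1\cap BV)(\mathbb R;[0,1])$ with $\bar\rho=0$ a.e. outside $\mathcal I_{\bar p}$. A solution on $[0,T]$ of the alternating micro–macro model with initial data $(\bar\rho,\bar p)$ consists of $\rho\in C^0([0,T];L^1(\mathbb R))$ with $\rho(t,\cdot)\in (L^1\cap BV)(\mathbb R;[0,1])$ for every $t\in[0,T]$, and of Lipschitz continuous functions $p^j_i$ on $[0,T]$,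 such that for every $t\in[0,T]$ the configuration $p(t)$ is admissible and $\rho(t,\cdot)=0$ a.e. outside $\mathcal I_{p(t)}$, and such that * $p(0)=\bar p$ and $\rho(0,\cdot)=\bar\rho$ a.e. on $\mathcal I_{\bar p}$; * $\rho$ is a Kružkov entropy solution of $\partial_t\rho+\partial_x(\rho v(\rho))=0$ in the macroscopic region: for all $k\in[0,1]$ and all non-negative $\varphi\in C^1_c(\left]0,T\right[\times\mathbb R)$ with support in $\{(t,x): x\in\mathcal I_{p(t)}\}$, $$\int_0^T\!\!\int_{\mathbb R}\Big(|\rho-k|\,\partial_t\varphi+\operatorname{sgn}(\rho-k)\big(\rho v(\rho)-k v(k)\big)\,\partial_x\varphi\Big)\,dx\,dt\ \ge 0;$$ * for $j=1,\dots,N$ and a.e. $\tau\in[0,T]$, the entropy solution $u^\tau$ of the Riemann problem for $\partial_t u+\partial_x(uv(u))=0$ posed at time $\tau$ at the point $p^j_1(\tau)$, with left state $\rho(\tau,p^j_1(\tau)-)$ and right state $\ell/(p^j_2(\tau)-p^j_1(\tau))$, satisfies $u^\tau(t,x)=\rho(\tau,p^j_1(\tau)-)$ for all $t>\tau$ and $x<p^j_1(\tau)+\dot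 p^j_1(\tau)(t-\tau)$; * $\dot p^j_i(t)=v\big(\ell/(p^j_{i+1}(t)-p^j_i(t))\big)$ for a.e. $t\in[0,T]$, $1\le i<n_j$, $1\le j\le N$; * $\dot p^j_{n_j}(t)=v\big(\rho(t,p^j_{n_j}(t)+)\big)$ for a.e. $t\in[0,T]$, $1\le j\le N$. Then every such solution $(\rho,p)$ satisfies $$\int_{p^j_{n_j}(t)}^{p^{j+1}_1(t)}\rho(t,x)\,dx=\int_{\bar p^j_{n_j}}^{\bar p^{j+1}_1}\bar\rho(x)\,dx\qquad\text{for all }t\in[0,T]\text{ and all }j=1,\dots,N-1.$$ -/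

import Mathlib

open MeasureTheory Set Filter Topology

namespace MicroMacro

/-- The condition on the speed law: `v ∈ C²([0,1]; ℝ⁺)` is strictly decreasing, `v(1) = 0`, and
the flux `r ↦ r v(r)` has negative second derivative. Only the values of `v` on `[0,1]` matter;
derivatives at the endpoints are one-sided. -/
structure SpeedLaw (v : ℝ → ℝ) : Prop where
  contDiffOn : ContDiffOn ℝ 2 v (Icc 0 1)
  nonneg : ∀ r ∈ Icc (0 : ℝ) 1, 0 ≤ v r
  strictAntiOn : StrictAntiOn v (Icc 0 1)
  map_one : v 1 = 0
  flux_concave : ∀ r ∈ Icc (0 : ℝ) 1,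
    iteratedDerivWithin 2 (fun s => s * v s) (Icc 0 1) r < 0

/-- The set of admissible positions `q 1, …, q n` of `n` vehicles of length `ℓ` (only the indices
`1, …, n` matter). -/
def positionSet (ℓ : ℝ) (n : ℕ) : Set (ℕ → ℝ) :=
  {q | ∀ i, 1 ≤ i → i < n → ℓ ≤ q (i + 1) - q i}

/-- The part of the real line where the macroscopic model is used, when there are `N` groups of
vehicles, and the `i`-th vehicle of the `j`-th group (`1 ≤ j ≤ N`, `1 ≤ i ≤ n j`) is at `q j i`. -/
def macroRegion (N : ℕ) (n : ℕ → ℕ) (q : ℕ → ℕ → ℝ) : Set ℝ :=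
  Iio (q 1 1) ∪ (⋃ (j : ℕ) (_ : 1 ≤ j ∧ j < N), Ioo (q j (n j)) (q (j + 1) 1)) ∪
    Ioi (q N (n N))

/-- Admissible positions of all groups: inside each group the mutual distances are at least `ℓ`, and
the groups alternate with the macroscopic segments along the line, that is, the leader of each
group is not beyond the tail of the next one. -/
structure AdmissiblePositions (ℓ : ℝ) (N : ℕ) (n : ℕ → ℕ) (q : ℕ → ℕ → ℝ) : Prop where
  mem_positionSet : ∀ j, 1 ≤ j → j ≤ N → q j ∈ positionSet ℓ (n j)
  ordered : ∀ j, 1 ≤ j → j < N → q j (n j) ≤ q (j + 1) 1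

/-- An element of `L¹(ℝ)` belongs to `(L¹ ∩ BV)(ℝ; [0,1])`: it takes values in `[0,1]` almost
everywhere and has a representative of bounded variation. -/
structure IsDensity (f : Lp ℝ 1 (volume : Measure ℝ)) : Prop where
  mem_Icc : ∀ᵐ x, f x ∈ Icc (0 : ℝ) 1
  bv : ∃ g : ℝ → ℝ, (f : ℝ → ℝ) =ᵐ[volume] g ∧ BoundedVariationOn g univ

/-- `f(a-) = r`, as an essential limit. -/
def HasLeftTrace (f : ℝ → ℝ) (a r : ℝ) : Prop :=
  Tendsto f (𝓝[<] a ⊓ ae volume) (𝓝 r)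

/-- `f(a+) = r`, as an essential limit. -/
def HasRightTrace (f : ℝ → ℝ) (a r : ℝ) : Prop :=
  Tendsto f (𝓝[>] a ⊓ ae volume) (𝓝 r)

/-- The admissibility condition on the initial data. -/
structure AdmissibleData (ℓ : ℝ) (N : ℕ) (n : ℕ → ℕ) (ρ₀ : Lp ℝ 1 (volume : Measure ℝ))
    (p₀ : ℕ → ℕ → ℝ) : Prop where
  density : IsDensity ρ₀
  vanish : ∀ᵐ x, x ∉ macroRegion N n p₀ → ρ₀ x = 0
  positions : AdmissiblePositions ℓ N n p₀

open Classical in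
/-- The entropy solution, as a function of `ξ = x / t`, of the Riemann problem for
`∂ₜ u + ∂ₓ f(u) = 0`, where `f` is a strictly concave flux on `[0,1]`, with left state `a` and right
state `b` in `[0,1]`. If `a ≤ b`, it is a shock, which travels with the Rankine–Hugoniot
speed. If `a > b`, it is a rarefaction wave: at `ξ` between `f'(a)` and `f'(b)`, its
value is the point `w` of `[b, a]` with `f'(w) = ξ`. -/
noncomputable def riemannSolution (f : ℝ → ℝ) (a b ξ : ℝ) : ℝ :=
  if a ≤ b then
    if ξ < (f b - f a) / (b - a) then a else b
  else
    if ξ ≤ derivWithin f (Icc 0 1) a then a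
    else if derivWithin f (Icc 0 1) b ≤ ξ then b
    else Function.invFunOn (derivWithin f (Icc 0 1)) (Icc b a) ξ

/-- Solutions on `[0,T]` of the micro–macro model with initial data `ρ₀`, `p₀`. Here `ρ t` is the
density at time `t` and `p j i t` is the position at time `t` of the `i`-th vehicle of the `j`-th
group, `1 ≤ j ≤ N`, `1 ≤ i ≤ n j`. -/
structure IsSolution (v : ℝ → ℝ) (ℓ : ℝ) (N : ℕ) (n : ℕ → ℕ)
    (ρ₀ : Lp ℝ 1 (volume : Measure ℝ)) (p₀ : ℕ → ℕ → ℝ) (T : ℝ)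
    (ρ : ℝ → Lp ℝ 1 (volume : Measure ℝ)) (p : ℕ → ℕ → ℝ → ℝ) : Prop where
  /-- `ρ ∈ C⁰([0,T]; (L¹ ∩ BV)(ℝ; [0,1]))`, with continuity in the `L¹` topology. -/
  continuousOn : ContinuousOn ρ (Icc 0 T)
  density : ∀ t ∈ Icc 0 T, IsDensity (ρ t)
  vanish : ∀ t ∈ Icc 0 T, ∀ᵐ x, x ∉ macroRegion N n (fun j i => p j i t) → ρ t x = 0
  /-- `pʲ ∈ W^{1,∞}([0,T])`, that is, `pʲ` is Lipschitz continuous. -/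
  lipschitz : ∀ j, 1 ≤ j → j ≤ N → ∀ i, 1 ≤ i → i ≤ n j →
    ∃ K, LipschitzOnWith K (p j i) (Icc 0 T)
  positions : ∀ t ∈ Icc 0 T, AdmissiblePositions ℓ N n (fun j i => p j i t)
  /-- The initial conditions. -/
  initial_density : ∀ᵐ x, x ∈ macroRegion N n p₀ → ρ 0 x = ρ₀ x
  initial_positions : ∀ j, 1 ≤ j → j ≤ N → ∀ i, 1 ≤ i → i ≤ n j → p j i 0 = p₀ j i
  /-- `ρ` is a Kružkov entropy solution of `∂ₜ ρ + ∂ₓ (ρ v(ρ)) = 0` in the macroscopic region. -/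
  entropy : ∀ φ : ℝ × ℝ → ℝ, ContDiff ℝ 1 φ → HasCompactSupport φ → (∀ z, 0 ≤ φ z) →
    tsupport φ ⊆ {z | z.1 ∈ Ioo 0 T ∧ z.2 ∈ macroRegion N n (fun j i => p j i z.1)} →
    ∀ k ∈ Icc (0 : ℝ) 1,
      0 ≤ ∫ t in (0 : ℝ)..T, ∫ x,
        (|ρ t x - k| * deriv (fun s => φ (s, x)) t +
          Real.sign (ρ t x - k) * (ρ t x * v (ρ t x) - k * v k) * deriv (fun y => φ (t, y)) x)
  /-- The boundary condition at the tail of each group: on the left of the line through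
  `(τ, p₁ʲ(τ))` with the speed of the tail, the solution of the Riemann problem with left state
  `ρ(τ, p₁ʲ(τ)-)` and right state `ℓ / (p₂ʲ(τ) - p₁ʲ(τ))` is equal to the left state. -/
  tail : ∀ j, 1 ≤ j → j ≤ N → ∀ᵐ τ, τ ∈ Icc 0 T →
    ∃ r s : ℝ, HasLeftTrace (ρ τ) (p j 1 τ) r ∧ HasDerivAt (p j 1) s τ ∧
      ∀ t x, τ < t → x < p j 1 τ + s * (t - τ) →
        riemannSolution (fun u => u * v u) r (ℓ / (p j 2 τ - p j 1 τ))
          ((x - p j 1 τ) / (t - τ)) = r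
  /-- The follow-the-leader equations. -/
  follower : ∀ j, 1 ≤ j → j ≤ N → ∀ i, 1 ≤ i → i < n j → ∀ᵐ t, t ∈ Icc 0 T →
    HasDerivAt (p j i) (v (ℓ / (p j (i + 1) t - p j i t))) t
  /-- The equation of the leader of each group. -/
  leader : ∀ j, 1 ≤ j → j ≤ N → ∀ᵐ t, t ∈ Icc 0 T →
    ∃ r, HasRightTrace (ρ t) (p j (n j) t) r ∧ HasDerivAt (p j (n j)) (v r) t

end MicroMacro

/-! Let `M` be the mass between the leader of one group and the tail of the next. Mass could only
change by flowing through the two bounding trajectories, and the flux relative to each of them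
vanishes. Behind nothing but its own speed rule, the leader moves at `v r`, with `r` the density
just ahead of it, so `r * v r - v r * r = 0`. The tail moves at `v σ`, where `σ = ℓ / gap`. Its
Riemann condition leaves only `r = 0` or `r = σ` for the density just behind it, because otherwise a
shock or rarefaction slower than `v σ` would enter the macroscopic side; in both cases `r * v r = v
σ * r` (`SpeedLaw.flux_eq_of_riemannSolution_eq`).

To turn this into conservation, the entropy inequalities for `k = 0` and `k = 1` are combined into
the weak equation (`IsSolution.weak`). It is tested against smoothed indicators of the strip between
the trajectories. These are only Lipschitz, so Steklov means replace them, and dominated convergence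
passes to the limit (`integral_deriv_mul_mass_eq_zero`). Hence `M` is locally constant while the
groups do not touch.

When they touch, the strip closes and the balance argument is unavailable, but then `M = 0`. A
continuous function that is locally constant wherever it is nonzero is constant on the interval
(`eqOn_const_of_locally_const`), so contacts do no harm. -/

namespace MicroMacro

/-! ### Smooth steps and their derivatives as one-sided averaging kernels -/

/-- A smooth monotone step from `0` on `Iic c` to `1` on `Ici (c + ε)`. -/
noncomputable def smoothStep (c ε x : ℝ) : ℝ := Real.smoothTransition ((x - c) / ε)

/-- The derivative of `smoothStep c ε`. -/
noncomputable def stepKernel (c ε x : ℝ) : ℝ := deriv Real.smoothTransition ((x - c) / ε) / ε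

lemma differentiable_smoothTransition : Differentiable ℝ Real.smoothTransition :=
  (Real.smoothTransition.contDiff (n := 1)).differentiable one_ne_zero

lemma continuous_deriv_smoothTransition : Continuous (deriv Real.smoothTransition) :=
  (Real.smoothTransition.contDiff (n := 1)).continuous_deriv le_rfl

lemma deriv_smoothTransition_nonneg (x : ℝ) : 0 ≤ deriv Real.smoothTransition x :=
  Real.smoothTransition.monotone.deriv_nonneg

lemma deriv_smoothTransition_eq_zero {x : ℝ} (hx : x ∉ Icc (0 : ℝ) 1) :
    deriv Real.smoothTransition x = 0 := by
  rcases lt_or_ge x 0 with h | h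
  · have : Real.smoothTransition =ᶠ[𝓝 x] fun _ => 0 := by
      filter_upwards [Iio_mem_nhds h] with y hy
      exact Real.smoothTransition.zero_of_nonpos (le_of_lt hy)
    rw [this.deriv_eq, deriv_const]
  · have h1 : 1 < x := by
      by_contra h'
      exact hx ⟨h, not_lt.1 h'⟩
    have : Real.smoothTransition =ᶠ[𝓝 x] fun _ => 1 := by
      filter_upwards [Ioi_mem_nhds h1] with y hy
      exact Real.smoothTransition.one_of_one_le (le_of_lt hy)
    rw [this.deriv_eq, deriv_const]

section Step

variable {c ε : ℝ}

lemma smoothStep_eq_zero (hε : 0 < ε) {x : ℝ} (hx : x ≤ c) : smoothStep c ε x = 0 :=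
  Real.smoothTransition.zero_of_nonpos (div_nonpos_of_nonpos_of_nonneg (by linarith) hε.le)

lemma smoothStep_eq_one (hε : 0 < ε) {x : ℝ} (hx : c + ε ≤ x) : smoothStep c ε x = 1 :=
  Real.smoothTransition.one_of_one_le ((one_le_div hε).2 (by linarith))

lemma smoothStep_nonneg (x : ℝ) : 0 ≤ smoothStep c ε x := Real.smoothTransition.nonneg _

lemma smoothStep_le_one (x : ℝ) : smoothStep c ε x ≤ 1 := Real.smoothTransition.le_one _

lemma smoothStep_anti_left (hε : 0 < ε) {c' : ℝ} (h : c ≤ c') (x : ℝ) :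
    smoothStep c' ε x ≤ smoothStep c ε x :=
  Real.smoothTransition.monotone (by gcongr)

lemma continuous_smoothStep : Continuous (smoothStep c ε) :=
  Real.smoothTransition.continuous.comp (by fun_prop)

lemma continuous_stepKernel : Continuous (stepKernel c ε) :=
  (continuous_deriv_smoothTransition.comp (by fun_prop)).div_const _

lemma stepKernel_nonneg (hε : 0 < ε) (x : ℝ) : 0 ≤ stepKernel c ε x :=
  div_nonneg (deriv_smoothTransition_nonneg _) hε.le

lemma stepKernel_eq_zero (hε : 0 < ε) {x : ℝ} (hx : x ∉ Icc c (c + ε)) :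
    stepKernel c ε x = 0 := by
  rw [stepKernel, deriv_smoothTransition_eq_zero, zero_div]
  intro h
  apply hx
  rw [mem_Icc, div_le_one hε, le_div_iff₀ hε] at h
  constructor <;> linarith [h.1, h.2]

lemma hasDerivAt_smoothStep (x : ℝ) : HasDerivAt (smoothStep c ε) (stepKernel c ε x) x := by
  have h := (differentiable_smoothTransition ((x - c) / ε)).hasDerivAt.comp x
    (((hasDerivAt_id x).sub_const c).div_const ε)
  refine h.congr_deriv ?_
  rw [stepKernel, mul_one_div]

lemma hasDerivAt_smoothStep_left {γ : ℝ → ℝ} {γ' t : ℝ} (hγ : HasDerivAt γ γ' t) (x : ℝ) :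
    HasDerivAt (fun s => smoothStep (γ s) ε x) (-γ' * stepKernel (γ t) ε x) t := by
  have h := (differentiable_smoothTransition ((x - γ t) / ε)).hasDerivAt.comp t
    ((hγ.const_sub x).div_const ε)
  refine h.congr_deriv ?_
  rw [stepKernel]
  ring

lemma hasCompactSupport_stepKernel (hε : 0 < ε) : HasCompactSupport (stepKernel c ε) :=
  HasCompactSupport.intro (isCompact_Icc (a := c) (b := c + ε)) fun _ hx =>
    stepKernel_eq_zero hε hx

lemma integrable_stepKernel (hε : 0 < ε) : Integrable (stepKernel c ε) :=
  continuous_stepKernel.integrable_of_hasCompactSupport (hasCompactSupport_stepKernel hε)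

lemma integral_stepKernel (hε : 0 < ε) : ∫ x, stepKernel c ε x = 1 := by
  have h := integral_of_hasDerivAt_of_tendsto (f := smoothStep c ε) (m := 0) (n := 1)
    (fun x => hasDerivAt_smoothStep x) (integrable_stepKernel hε)
    (tendsto_const_nhds.congr' (by
      filter_upwards [eventually_le_atBot c] with x hx using (smoothStep_eq_zero hε hx).symm))
    (tendsto_const_nhds.congr' (by
      filter_upwards [eventually_ge_atTop (c + ε)] with x hx using (smoothStep_eq_one hε hx).symm))
  simpa using h

lemma abs_integral_mul_stepKernel_le (hε : 0 < ε) {g : ℝ → ℝ} {C : ℝ}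
    (hg : ∀ᵐ x, |g x| ≤ C) : |∫ x, g x * stepKernel c ε x| ≤ C := by
  have h := norm_integral_le_of_norm_le (f := fun x => g x * stepKernel c ε x)
    ((integrable_stepKernel (c := c) hε).const_mul C) (by
      filter_upwards [hg] with x hx
      rw [norm_mul, Real.norm_eq_abs, Real.norm_of_nonneg (stepKernel_nonneg hε x)]
      exact mul_le_mul_of_nonneg_right hx (stepKernel_nonneg hε x))
  rwa [integral_const_mul, integral_stepKernel hε, mul_one] at h

end Step

/-- The kernels are probability densities whose supports shrink along `l`, so they average `g` near
its limit. Meeting `l` with `ae volume` suffices since the integral ignores null sets. Keeping `l`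
free covers left and right traces as well as closed half-neighbourhoods. -/
lemma tendsto_integral_mul_stepKernel {l : Filter ℝ} {c ε : ℕ → ℝ} (hε : ∀ m, 0 < ε m)
    (hl : Tendsto (fun m => Icc (c m) (c m + ε m)) atTop l.smallSets) {g : ℝ → ℝ} {r : ℝ}
    (hg : Tendsto g (l ⊓ ae volume) (𝓝 r))
    (hi : ∀ m, Integrable fun x => g x * stepKernel (c m) (ε m) x) :
    Tendsto (fun m => ∫ x, g x * stepKernel (c m) (ε m) x) atTop (𝓝 r) := by
  rw [Metric.tendsto_atTop']
  intro η hη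
  have h2 : {x | |g x - r| ≤ η / 2} ∈ l ⊓ ae volume := by
    filter_upwards [hg (Metric.ball_mem_nhds r (half_pos hη))] with x hx
    have : dist (g x) r < η / 2 := hx
    rw [Real.dist_eq] at this
    exact this.le
  obtain ⟨s, hs, t, ht, hst⟩ := mem_inf_iff_superset.1 h2
  obtain ⟨m₀, hm₀⟩ := eventually_atTop.1 ((tendsto_smallSets_iff.1 hl) s hs)
  refine ⟨m₀, fun m hm => ?_⟩
  have hsub := hm₀ m hm.le
  have hk := integrable_stepKernel (c := c m) (hε m)
  have heq : (∫ x, g x * stepKernel (c m) (ε m) x) - r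
      = ∫ x, (g x - r) * stepKernel (c m) (ε m) x := by
    simp_rw [sub_mul]
    rw [integral_sub (hi m) (hk.const_mul r), integral_const_mul, integral_stepKernel (hε m),
      mul_one]
  have hle : |∫ x, (g x - r) * stepKernel (c m) (ε m) x| ≤ η / 2 := by
    have h := norm_integral_le_of_norm_le (f := fun x => (g x - r) * stepKernel (c m) (ε m) x)
      (hk.const_mul (η / 2)) (by
        filter_upwards [ht] with x hx
        rw [norm_mul, Real.norm_eq_abs, Real.norm_of_nonneg (stepKernel_nonneg (hε m) x)]
        by_cases hxc : x ∈ Icc (c m) (c m + ε m)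
        · exact mul_le_mul_of_nonneg_right (hst ⟨hsub hxc, hx⟩) (stepKernel_nonneg (hε m) x)
        · simp [stepKernel_eq_zero (hε m) hxc])
    rwa [integral_const_mul, integral_stepKernel (hε m), mul_one] at h
  rw [Real.dist_eq, heq]
  linarith

lemma tendsto_Icc_smallSets_nhdsGT {a : ℝ} {c ε : ℕ → ℝ} (hc : ∀ m, a < c m)
    (hce : Tendsto (fun m => c m + ε m) atTop (𝓝 a)) :
    Tendsto (fun m => Icc (c m) (c m + ε m)) atTop (𝓝[>] a).smallSets := by
  rw [tendsto_smallSets_iff]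
  intro s hs
  obtain ⟨u, hu, hus⟩ := mem_nhdsGT_iff_exists_Ioo_subset.1 hs
  filter_upwards [hce (Iio_mem_nhds hu)] with m hm x hx
  exact hus ⟨(hc m).trans_le hx.1, hx.2.trans_lt hm⟩

lemma tendsto_Icc_smallSets_nhdsLT {a : ℝ} {c ε : ℕ → ℝ} (hc : ∀ m, c m + ε m < a)
    (hce : Tendsto c atTop (𝓝 a)) :
    Tendsto (fun m => Icc (c m) (c m + ε m)) atTop (𝓝[<] a).smallSets := by
  rw [tendsto_smallSets_iff]
  intro s hs
  obtain ⟨u, hu, hus⟩ := mem_nhdsLT_iff_exists_Ioo_subset.1 hs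
  filter_upwards [hce (Ioi_mem_nhds hu)] with m hm x hx
  exact hus ⟨lt_of_lt_of_le hm hx.1, hx.2.trans_lt (hc m)⟩

/-! ### Steklov regularization of Lipschitz curves -/

/-- The forward mean of `a` over an interval of length `δ`. -/
noncomputable def steklovMean (a : ℝ → ℝ) (δ t : ℝ) : ℝ := (∫ x in t..t + δ, a x) / δ

lemma hasDerivAt_steklovMean {a : ℝ → ℝ} (ha : Continuous a) (δ t : ℝ) :
    HasDerivAt (steklovMean a δ) ((a (t + δ) - a t) / δ) t := by
  have hd : ∀ y, HasDerivAt (fun u => ∫ x in (0 : ℝ)..u, a x) (a y) y := fun y =>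
    ha.integral_hasStrictDerivAt 0 y |>.hasDerivAt
  have h := (((hd (t + δ)).comp_add_const t δ).sub (hd t)).div_const δ
  refine h.congr_of_eventuallyEq (Eventually.of_forall fun s => ?_)
  simp only [steklovMean, Pi.sub_apply]
  congr 1
  exact (intervalIntegral.integral_interval_sub_left (μ := volume) (ha.intervalIntegrable _ _)
    (ha.intervalIntegrable _ _)).symm

lemma contDiff_steklovMean {a : ℝ → ℝ} (ha : Continuous a) (δ : ℝ) :
    ContDiff ℝ 1 (steklovMean a δ) := by
  rw [contDiff_one_iff_deriv]
  refine ⟨fun t => (hasDerivAt_steklovMean ha δ t).differentiableAt, ?_⟩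
  rw [funext fun t => (hasDerivAt_steklovMean ha δ t).deriv]
  fun_prop

lemma abs_steklovMean_sub_le {a : ℝ → ℝ} {K : NNReal} (ha : LipschitzWith K a) {δ : ℝ}
    (hδ : 0 < δ) (t : ℝ) : |steklovMean a δ t - a t| ≤ K * δ := by
  have h1 : steklovMean a δ t - a t = (∫ x in t..t + δ, (a x - a t)) / δ := by
    rw [intervalIntegral.integral_sub (ha.continuous.intervalIntegrable _ _) (by simp),
      intervalIntegral.integral_const, steklovMean, sub_div]
    simp [hδ.ne']
  have h2 : ‖∫ x in t..t + δ, (a x - a t)‖ ≤ K * δ * |t + δ - t| := by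
    refine intervalIntegral.norm_integral_le_of_norm_le_const fun x hx => ?_
    rw [uIoc_of_le (by linarith)] at hx
    have := ha.dist_le_mul x t
    rw [Real.dist_eq, Real.dist_eq, abs_of_nonneg (by linarith [hx.1] : 0 ≤ x - t)] at this
    exact this.trans (mul_le_mul_of_nonneg_left (by linarith [hx.2]) K.2)
  rw [h1, abs_div, abs_of_pos hδ, div_le_iff₀ hδ]
  simpa [abs_of_pos hδ] using h2

/-- The difference quotient is the derivative of the Steklov mean; this uniform bound provides the
domination in the limit of the mass balance. -/
lemma abs_slope_le {a : ℝ → ℝ} {K : NNReal} (ha : LipschitzWith K a) {δ : ℝ}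
    (hδ : 0 < δ) (t : ℝ) : |(a (t + δ) - a t) / δ| ≤ K := by
  have := ha.dist_le_mul (t + δ) t
  rw [Real.dist_eq, Real.dist_eq, add_sub_cancel_left, abs_of_pos hδ] at this
  rwa [abs_div, abs_of_pos hδ, div_le_iff₀ hδ]

lemma tendsto_slope {a : ℝ → ℝ} {d t : ℝ} (h : HasDerivAt a d t) {δ : ℕ → ℝ}
    (hδ : ∀ m, 0 < δ m) (hδ0 : Tendsto δ atTop (𝓝 0)) :
    Tendsto (fun m => (a (t + δ m) - a t) / δ m) atTop (𝓝 d) := by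
  have h1 := hasDerivAt_iff_tendsto_slope_zero.1 h
  have h2 : Tendsto δ atTop (𝓝[≠] 0) :=
    tendsto_nhdsWithin_iff.2 ⟨hδ0, Eventually.of_forall fun m => (hδ m).ne'⟩
  refine (h1.comp h2).congr fun m => ?_
  simp [div_eq_inv_mul]

/-! ### Continuity in time of integrals of `L¹`-valued curves -/

lemma integrable_Lp_mul (u : Lp ℝ 1 (volume : Measure ℝ)) {g : ℝ → ℝ} (hg : Continuous g)
    {C : ℝ} (hC : ∀ x, |g x| ≤ C) : Integrable fun x => u x * g x :=
  (L1.integrable_coeFn u).mul_bdd hg.aestronglyMeasurable (Eventually.of_forall hC)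

lemma integrable_Lp_mul_of_hasCompactSupport (u : Lp ℝ 1 (volume : Measure ℝ)) {g : ℝ → ℝ}
    (hg : Continuous g) (hc : HasCompactSupport g) : Integrable fun x => u x * g x := by
  obtain ⟨C, hC⟩ := hc.exists_bound_of_continuous hg
  exact integrable_Lp_mul u hg hC

lemma abs_integral_Lp_mul_le (u : Lp ℝ 1 (volume : Measure ℝ)) {g : ℝ → ℝ}
    {C : ℝ} (hC : ∀ x, |g x| ≤ C) : |∫ x, u x * g x| ≤ C * ‖u‖ := by
  have h := norm_integral_le_of_norm_le (f := fun x => u x * g x)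
    ((L1.integrable_coeFn u).norm.const_mul C) (Eventually.of_forall fun x => by
      rw [norm_mul, mul_comm]
      exact mul_le_mul_of_nonneg_right (hC x) (norm_nonneg _))
  rwa [integral_const_mul, ← L1.norm_eq_integral_norm] at h

lemma continuousOn_integral_Lp_mul {u : ℝ → Lp ℝ 1 (volume : Measure ℝ)} {s : Set ℝ}
    (hu : ContinuousOn u s) {g : ℝ × ℝ → ℝ} (hg : Continuous g) {C : ℝ} (hC : ∀ z, |g z| ≤ C) :
    ContinuousOn (fun t => ∫ x, u t x * g (t, x)) s := by
  intro t₀ ht₀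
  have hgt : ∀ t, Continuous fun x => g (t, x) := fun t => by fun_prop
  -- Split off the variation of `u`, controlled by the `L¹` norm; with `u t₀` frozen, dominated
  -- convergence handles the variation of `g`.
  have h1 : Tendsto (fun t => ∫ x, (u t - u t₀ : Lp ℝ 1 (volume : Measure ℝ)) x * g (t, x))
      (𝓝[s] t₀) (𝓝 0) := by
    have h2 : Tendsto (fun t => C * ‖u t - u t₀‖) (𝓝[s] t₀) (𝓝 0) := by
      have := ((hu t₀ ht₀).tendsto.sub_const (u t₀)).norm.const_mul C
      simpa using this
    exact squeeze_zero_norm (fun t => abs_integral_Lp_mul_le _ fun x => hC (t, x)) h2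
  have h3 : Continuous fun t => ∫ x, u t₀ x * g (t, x) := by
    refine continuous_of_dominated (bound := fun x => C * ‖u t₀ x‖)
      (fun t => (integrable_Lp_mul _ (hgt t) fun x => hC (t, x)).aestronglyMeasurable)
      (fun t => Eventually.of_forall fun x => ?_) ((L1.integrable_coeFn _).norm.const_mul C)
      (Eventually.of_forall fun x => by fun_prop)
    rw [norm_mul, mul_comm]
    exact mul_le_mul_of_nonneg_right (hC _) (norm_nonneg _)
  have h4 := h1.add (h3.continuousWithinAt (s := s) (x := t₀)).tendsto
  rw [zero_add] at h4
  refine h4.congr fun t => ?_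
  rw [← integral_add (integrable_Lp_mul _ (hgt t) fun x => hC (t, x))
    (integrable_Lp_mul _ (hgt t) fun x => hC (t, x))]
  refine integral_congr_ae ?_
  filter_upwards [Lp.coeFn_sub (u t) (u t₀)] with x hx
  rw [hx, Pi.sub_apply]
  ring

/-- The integral of an `L¹`-continuous family over a moving interval is continuous. -/
lemma continuousOn_intervalIntegral_Lp {u : ℝ → Lp ℝ 1 (volume : Measure ℝ)} {s : Set ℝ}
    (hu : ContinuousOn u s) {a b : ℝ → ℝ} (ha : ContinuousOn a s) (hb : ContinuousOn b s) :
    ContinuousOn (fun t => ∫ x in a t..b t, u t x) s := by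
  intro t₀ ht₀
  have hint : ∀ (w : Lp ℝ 1 (volume : Measure ℝ)) y z, IntervalIntegrable w volume y z :=
    fun w y z => (L1.integrable_coeFn w).intervalIntegrable
  have h1 : Tendsto (fun t => ∫ x in a t..b t, (u t - u t₀ : Lp ℝ 1 (volume : Measure ℝ)) x)
      (𝓝[s] t₀) (𝓝 0) := by
    have h2 : Tendsto (fun t => ‖u t - u t₀‖) (𝓝[s] t₀) (𝓝 0) := by
      have := ((hu t₀ ht₀).tendsto.sub_const (u t₀)).norm
      simpa using this
    refine squeeze_zero_norm (fun t => ?_) h2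
    rw [L1.norm_eq_integral_norm]
    refine intervalIntegral.norm_integral_le_integral_norm_uIoc.trans ?_
    exact setIntegral_le_integral (L1.integrable_coeFn _).norm
      (Eventually.of_forall fun x => norm_nonneg _)
  have hP : Continuous fun y => ∫ x in (0 : ℝ)..y, u t₀ x :=
    intervalIntegral.continuous_primitive (fun y z => hint _ y z) 0
  have h3 : Tendsto (fun t => ∫ x in a t..b t, u t₀ x) (𝓝[s] t₀)
      (𝓝 (∫ x in a t₀..b t₀, u t₀ x)) := by
    have := (((hP.tendsto _).comp (hb t₀ ht₀)).sub ((hP.tendsto _).comp (ha t₀ ht₀)))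
    simp only [Function.comp_def] at this
    simpa [intervalIntegral.integral_interval_sub_left (hint _ _ _) (hint _ _ _)] using this
  have h4 := h1.add h3
  rw [zero_add] at h4
  refine h4.congr fun t => ?_
  rw [← intervalIntegral.integral_add (hint _ _ _) (hint _ _ _)]
  refine intervalIntegral.integral_congr_ae ?_
  filter_upwards [Lp.coeFn_sub (u t) (u t₀)] with x hx _
  rw [hx, Pi.sub_apply]
  ring

/-- A function which is continuous on an interval, and locally constant wherever it does not vanish
in the interior, is constant. -/
lemma eqOn_const_of_locally_const {M : ℝ → ℝ} {T : ℝ} (hT : 0 < T)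
    (hM : ContinuousOn M (Icc 0 T))
    (hloc : ∀ t ∈ Ioo 0 T, M t ≠ 0 → ∀ᶠ s in 𝓝 t, M s = M t) :
    ∀ t ∈ Icc 0 T, M t = M 0 := by
  have hint : ∃ c, ∀ t ∈ Ioo 0 T, M t = c := by
    by_cases h0 : ∀ t ∈ Ioo 0 T, M t = 0
    · exact ⟨0, h0⟩
    push Not at h0
    obtain ⟨t₀, ht₀, hne⟩ := h0
    refine ⟨M t₀, ?_⟩
    have : PreconnectedSpace (Ioo 0 T) := isPreconnected_iff_preconnectedSpace.1 isPreconnected_Ioo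
    have hcont : Continuous fun t : Ioo 0 T => M t :=
      (continuousOn_iff_continuous_domRestrict.1 (hM.mono Ioo_subset_Icc_self))
    -- Openness uses `M t₀ ≠ 0`: every point of this level set then has a nonzero value, so `hloc`
    -- applies there.
    have hclopen : IsClopen {t : Ioo 0 T | M t = M t₀} := by
      refine ⟨isClosed_eq hcont continuous_const, isOpen_iff_mem_nhds.2 fun t ht => ?_⟩
      have ht' : M t = M t₀ := ht
      have := hloc t t.2 (by rwa [ht'])
      filter_upwards [continuous_subtype_val.continuousAt.eventually this] with s hs
      exact hs.trans ht'
    have huniv := hclopen.eq_univ ⟨⟨t₀, ht₀⟩, rfl⟩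
    intro t ht
    exact huniv.ge (mem_univ (⟨t, ht⟩ : Ioo 0 T))
  obtain ⟨c, hc⟩ := hint
  have hEq : EqOn M (fun _ => c) (Icc 0 T) :=
    EqOn.of_subset_closure (s := Ioo 0 T) hc hM continuousOn_const Ioo_subset_Icc_self
      (closure_Ioo hT.ne).ge
  intro t ht
  rw [hEq ht, hEq (left_mem_Icc.2 hT.le)]

/-! ### Concave flux and the Riemann condition at a tail -/

namespace SpeedLaw

variable {v : ℝ → ℝ} (hv : SpeedLaw v)
include hv

lemma contDiffOn_flux : ContDiffOn ℝ 2 (fun s => s * v s) (Icc 0 1) :=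
  contDiffOn_id.mul hv.contDiffOn

lemma differentiableOn_flux : DifferentiableOn ℝ (fun s => s * v s) (Icc 0 1) :=
  hv.contDiffOn_flux.differentiableOn two_ne_zero

lemma strictAntiOn_derivWithin_flux :
    StrictAntiOn (derivWithin (fun s => s * v s) (Icc 0 1)) (Icc 0 1) := by
  have hu : UniqueDiffOn ℝ (Icc (0 : ℝ) 1) := uniqueDiffOn_Icc zero_lt_one
  refine strictAntiOn_of_deriv_neg (convex_Icc 0 1)
    (hv.contDiffOn_flux.continuousOn_derivWithin hu one_le_two) fun x hx => ?_
  rw [interior_Icc] at hx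
  have h := hv.flux_concave x (Ioo_subset_Icc_self hx)
  rw [iteratedDerivWithin_succ, iteratedDerivWithin_one] at h
  rwa [← derivWithin_of_mem_nhds (Icc_mem_nhds hx.1 hx.2)]

/-- `v σ` is the slope of the chord of the flux from `0` to `σ`, hence the derivative at some `c <
σ`, and the derivative strictly decreases. -/
lemma derivWithin_flux_lt {σ : ℝ} (h0 : 0 < σ) (h1 : σ ≤ 1) :
    derivWithin (fun s => s * v s) (Icc 0 1) σ < v σ := by
  obtain ⟨c, hc, hc'⟩ := exists_deriv_eq_slope (fun s => s * v s) h0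
    (hv.differentiableOn_flux.continuousOn.mono (Icc_subset_Icc_right h1))
    (fun x hx => ((hv.differentiableOn_flux x ⟨hx.1.le, hx.2.le.trans h1⟩).differentiableAt
      (Icc_mem_nhds hx.1 (hx.2.trans_le h1))).differentiableWithinAt)
  have h2 := hv.strictAntiOn_derivWithin_flux ⟨hc.1.le, hc.2.le.trans h1⟩ ⟨h0.le, h1⟩ hc.2
  rw [derivWithin_of_mem_nhds (Icc_mem_nhds hc.1 (hc.2.trans_le h1)), hc'] at h2
  simpa [mul_div_cancel_left₀ _ h0.ne'] using h2

/-- A globally Lipschitz extension vanishing at `0` acts continuously on `L¹`, so the flux of the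
density becomes an `L¹`-continuous curve. -/
lemma exists_lipschitz_flux : ∃ (K : NNReal) (F : ℝ → ℝ), LipschitzWith K F ∧ F 0 = 0 ∧
    ∀ u ∈ Icc (0 : ℝ) 1, F u = u * v u := by
  obtain ⟨K, hK⟩ := (hv.contDiffOn_flux.of_le one_le_two).exists_lipschitzOnWith one_ne_zero
    (convex_Icc 0 1) isCompact_Icc
  obtain ⟨F, hF, hEq⟩ := hK.extend_real
  refine ⟨K, F, hF, ?_, fun u hu => (hEq hu).symm⟩
  rw [← hEq ⟨le_rfl, zero_le_one⟩]
  simp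

/-- If the solution of a Riemann problem with right state `σ` equals its left state `r` for all
speeds below `v σ`, then the flux of `r` relative to the speed `v σ` vanishes. -/
lemma flux_eq_of_riemannSolution_eq {r σ : ℝ} (hr : r ∈ Icc (0 : ℝ) 1) (hσ0 : 0 < σ)
    (hσ1 : σ ≤ 1) (h : ∀ ξ < v σ, riemannSolution (fun u => u * v u) r σ ξ = r) :
    r * v r = v σ * r := by
  rcases lt_trichotomy r σ with hlt | rfl | hgt
  -- Shock case. If `r > 0`, then `v r > v σ` makes the shock slower than `v σ`, so the value `σ ≠
  -- r` appears at the shock speed itself.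
  · rcases hr.1.eq_or_lt with h0 | h0
    · simp [← h0]
    · exfalso
      have hvr := hv.strictAntiOn hr ⟨hσ0.le, hσ1⟩ hlt
      have hsp : (σ * v σ - r * v r) / (σ - r) < v σ := by
        rw [div_lt_iff₀ (sub_pos.2 hlt)]
        nlinarith
      have := h _ hsp
      simp only [riemannSolution, if_pos hlt.le, lt_irrefl, if_false] at this
      exact hlt.ne' this
  · exact mul_comm _ _
  -- Rarefaction case. The fan ends at speed `f' σ < v σ`, where the solution already equals `σ ≠
  -- r`.
  · exfalso
    have h1 := hv.derivWithin_flux_lt hσ0 hσ1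
    have h2 := hv.strictAntiOn_derivWithin_flux ⟨hσ0.le, hσ1⟩ hr hgt
    have := h _ h1
    simp only [riemannSolution, if_neg hgt.not_ge, if_neg h2.not_ge, le_refl, if_true] at this
    exact hgt.ne this

end SpeedLaw

/-! ### Essential traces -/

lemma neBot_nhdsLT_inf_ae (a : ℝ) : (𝓝[<] a ⊓ ae (volume : Measure ℝ)).NeBot := by
  rw [inf_neBot_iff]
  intro s hs t ht
  obtain ⟨u, hu, hus⟩ := mem_nhdsLT_iff_exists_Ioo_subset.1 hs
  by_contra hne
  rw [not_nonempty_iff_eq_empty, ← disjoint_iff_inter_eq_empty] at hne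
  have h0 : volume (Ioo u a) = 0 :=
    measure_mono_null (fun x hx hxt => hne.ne_of_mem (hus hx) hxt rfl) (mem_ae_iff.1 ht)
  rw [Real.volume_Ioo, ENNReal.ofReal_eq_zero] at h0
  exact absurd (mem_Iio.1 hu) (by linarith)

lemma neBot_nhdsGT_inf_ae (a : ℝ) : (𝓝[>] a ⊓ ae (volume : Measure ℝ)).NeBot := by
  rw [inf_neBot_iff]
  intro s hs t ht
  obtain ⟨u, hu, hus⟩ := mem_nhdsGT_iff_exists_Ioo_subset.1 hs
  by_contra hne
  rw [not_nonempty_iff_eq_empty, ← disjoint_iff_inter_eq_empty] at hne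
  have h0 : volume (Ioo a u) = 0 :=
    measure_mono_null (fun x hx hxt => hne.ne_of_mem (hus hx) hxt rfl) (mem_ae_iff.1 ht)
  rw [Real.volume_Ioo, ENNReal.ofReal_eq_zero] at h0
  exact absurd (mem_Ioi.1 hu) (by linarith)

lemma mem_Icc_of_tendsto_inf_ae {f : ℝ → ℝ} {l : Filter ℝ} [(l ⊓ ae (volume : Measure ℝ)).NeBot]
    {r : ℝ} (hf : ∀ᵐ x, f x ∈ Icc (0 : ℝ) 1) (h : Tendsto f (l ⊓ ae volume) (𝓝 r)) :
    r ∈ Icc (0 : ℝ) 1 :=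
  isClosed_Icc.mem_of_tendsto h (hf.filter_mono inf_le_right)

/-! ### From entropy inequalities to the weak equation -/

section TestFunction

variable {φ : ℝ × ℝ → ℝ}

lemma deriv_fst_eq (hφ : ContDiff ℝ 1 φ) (t x : ℝ) :
    deriv (fun s => φ (s, x)) t = fderiv ℝ φ (t, x) (1, 0) := by
  have h := ((hφ.differentiable one_ne_zero) (t, x)).hasFDerivAt.comp_hasDerivAt t
    ((hasDerivAt_id t).prodMk (hasDerivAt_const t x))
  exact h.deriv

lemma deriv_snd_eq (hφ : ContDiff ℝ 1 φ) (t x : ℝ) :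
    deriv (fun y => φ (t, y)) x = fderiv ℝ φ (t, x) (0, 1) := by
  have h := ((hφ.differentiable one_ne_zero) (t, x)).hasFDerivAt.comp_hasDerivAt x
    ((hasDerivAt_const x t).prodMk (hasDerivAt_id x))
  exact h.deriv

lemma continuous_fderiv_apply' (hφ : ContDiff ℝ 1 φ) (w : ℝ × ℝ) :
    Continuous fun z => fderiv ℝ φ z w :=
  (hφ.continuous_fderiv one_ne_zero).clm_apply continuous_const

/-- Fubini and the vanishing of `φ` at times `0` and `T`. This removes the constant in `|ρ - 1| = 1
- ρ` when the entropy inequality is used with `k = 1`. -/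
lemma integral_integral_deriv_fst_eq_zero (hφ : ContDiff ℝ 1 φ) (hc : HasCompactSupport φ) {T : ℝ}
    (hT : 0 < T) (hsupp : tsupport φ ⊆ {z | z.1 ∈ Ioo 0 T}) :
    ∫ t in (0 : ℝ)..T, ∫ x, fderiv ℝ φ (t, x) (1, 0) = 0 := by
  have hcont := continuous_fderiv_apply' hφ (1, 0)
  have hint : Integrable (fun z => fderiv ℝ φ z (1, 0)) (volume.prod volume) :=
    hcont.integrable_of_hasCompactSupport (hc.fderiv_apply ℝ (1, 0))
  rw [intervalIntegral.integral_of_le hT.le, integral_integral_swap]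
  · refine integral_eq_zero_of_ae (Eventually.of_forall fun x => ?_)
    beta_reduce
    rw [Pi.zero_apply, ← intervalIntegral.integral_of_le hT.le,
      intervalIntegral.integral_eq_sub_of_hasDerivAt (f := fun s => φ (s, x))]
    · have h0 : φ (0, x) = 0 := image_eq_zero_of_notMem_tsupport fun h => (hsupp h).1.false
      have h1 : φ (T, x) = 0 := image_eq_zero_of_notMem_tsupport fun h => (hsupp h).2.false
      rw [h0, h1, sub_zero]
    · intro t _
      rw [← deriv_fst_eq hφ]
      have : Differentiable ℝ φ := hφ.differentiable one_ne_zero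
      exact DifferentiableAt.hasDerivAt (by fun_prop)
    · exact (hcont.comp (by fun_prop : Continuous fun t : ℝ => (t, x))).intervalIntegrable _ _
  · have : (volume.restrict (Ioc 0 T)).prod (volume : Measure ℝ)
        ≤ (volume : Measure ℝ).prod volume := by
      calc _ = (volume.restrict (Ioc 0 T)).prod ((volume : Measure ℝ).restrict univ) := by
            rw [Measure.restrict_univ]
        _ = ((volume : Measure ℝ).prod volume).restrict (Ioc 0 T ×ˢ univ) :=
            Measure.prod_restrict _ _
        _ ≤ _ := Measure.restrict_le_self
    exact hint.mono_measure this

end TestFunction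

/-- An entropy solution is a weak solution, tested against nonnegative functions. -/
lemma IsSolution.weak {v : ℝ → ℝ} {ℓ : ℝ} {N : ℕ} {n : ℕ → ℕ}
    {ρ₀ : Lp ℝ 1 (volume : Measure ℝ)} {p₀ : ℕ → ℕ → ℝ} {T : ℝ}
    {ρ : ℝ → Lp ℝ 1 (volume : Measure ℝ)} {p : ℕ → ℕ → ℝ → ℝ}
    (hsol : IsSolution v ℓ N n ρ₀ p₀ T ρ p) (hv : SpeedLaw v) (hT : 0 < T) {K : NNReal}
    {F : ℝ → ℝ} (hF : LipschitzWith K F) (hF0 : F 0 = 0)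
    (hFv : ∀ u ∈ Icc (0 : ℝ) 1, F u = u * v u) {φ : ℝ × ℝ → ℝ} (hφ : ContDiff ℝ 1 φ)
    (hc : HasCompactSupport φ) (hpos : ∀ z, 0 ≤ φ z)
    (hsupp : tsupport φ ⊆
      {z | z.1 ∈ Ioo 0 T ∧ z.2 ∈ macroRegion N n (fun j i => p j i z.1)}) :
    ∫ t in (0 : ℝ)..T, ∫ x, (ρ t x * fderiv ℝ φ (t, x) (1, 0)
      + hF.compLp hF0 (ρ t) x * fderiv ℝ φ (t, x) (0, 1)) = 0 := by
  have hct := continuous_fderiv_apply' hφ (1, 0)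
  have hcx := continuous_fderiv_apply' hφ (0, 1)
  obtain ⟨Ct, hCt⟩ := (hc.fderiv_apply ℝ (1, 0)).exists_bound_of_continuous hct
  obtain ⟨Cx, hCx⟩ := (hc.fderiv_apply ℝ (0, 1)).exists_bound_of_continuous hcx
  have hi1 : ∀ t, Integrable fun x => ρ t x * fderiv ℝ φ (t, x) (1, 0) := fun t =>
    integrable_Lp_mul (ρ t) (hct.comp (by fun_prop : Continuous fun x : ℝ => (t, x)))
      fun x => hCt (t, x)
  have hi2 : ∀ t, Integrable fun x => hF.compLp hF0 (ρ t) x * fderiv ℝ φ (t, x) (0, 1) :=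
    fun t => integrable_Lp_mul _ (hcx.comp (by fun_prop : Continuous fun x : ℝ => (t, x)))
      fun x => hCx (t, x)
  have hi12 : ∀ t, Integrable fun x => ρ t x * fderiv ℝ φ (t, x) (1, 0)
      + hF.compLp hF0 (ρ t) x * fderiv ℝ φ (t, x) (0, 1) := fun t => (hi1 t).add (hi2 t)
  have hi3 : ∀ t, Integrable fun x => fderiv ℝ φ (t, x) (1, 0) := fun t =>
    (hct.comp (by fun_prop : Continuous fun x : ℝ => (t, x))).integrable_of_hasCompactSupport
      (HasCompactSupport.intro ((hc.fderiv_apply ℝ (1, 0)).isCompact.image continuous_snd)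
        fun x hx => image_eq_zero_of_notMem_tsupport (f := fun z => fderiv ℝ φ z (1, 0))
          fun h => hx ⟨_, h, rfl⟩)
  have hJ : IntervalIntegrable (fun t => ∫ x, (ρ t x * fderiv ℝ φ (t, x) (1, 0)
      + hF.compLp hF0 (ρ t) x * fderiv ℝ φ (t, x) (0, 1))) volume 0 T := by
    refine ContinuousOn.intervalIntegrable ?_
    rw [uIcc_of_le hT.le]
    refine ((continuousOn_integral_Lp_mul hsol.continuousOn hct hCt).add
      (continuousOn_integral_Lp_mul ((hF.continuous_compLp hF0).comp_continuousOn
        hsol.continuousOn) hcx hCx)).congr fun t _ => ?_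
    exact integral_add (hi1 t) (hi2 t)
  have hdt : IntervalIntegrable (fun t => ∫ x, fderiv ℝ φ (t, x) (1, 0)) volume 0 T := by
    have hint : Integrable (fun z => fderiv ℝ φ z (1, 0)) (volume.prod volume) :=
      hct.integrable_of_hasCompactSupport (hc.fderiv_apply ℝ (1, 0))
    exact hint.integral_prod_left.intervalIntegrable
  -- As `0 ≤ ρ ≤ 1` and both constant states `0` and `1` have zero flux, `k = 0` says that the weak
  -- expression is nonnegative and `k = 1` that it is nonpositive.
  have e0 := hsol.entropy φ hφ hc hpos hsupp 0 ⟨le_rfl, zero_le_one⟩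
  have e1 := hsol.entropy φ hφ hc hpos hsupp 1 ⟨zero_le_one, le_rfl⟩
  have hflux : ∀ t ∈ Icc 0 T, ∀ᵐ x, ρ t x ∈ Icc (0 : ℝ) 1 ∧
      hF.compLp hF0 (ρ t) x = ρ t x * v (ρ t x) := by
    intro t ht
    filter_upwards [(hsol.density t ht).mem_Icc, hF.coeFn_compLp hF0 (ρ t)] with x hx hx'
    exact ⟨hx, by rw [hx', Function.comp_apply, hFv _ hx]⟩
  have h0 : (∫ t in (0 : ℝ)..T, ∫ x,
        (|ρ t x - 0| * deriv (fun s => φ (s, x)) t +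
          Real.sign (ρ t x - 0) * (ρ t x * v (ρ t x) - 0 * v 0) * deriv (fun y => φ (t, y)) x))
      = ∫ t in (0 : ℝ)..T, ∫ x, (ρ t x * fderiv ℝ φ (t, x) (1, 0)
        + hF.compLp hF0 (ρ t) x * fderiv ℝ φ (t, x) (0, 1)) := by
    refine intervalIntegral.integral_congr fun t ht => ?_
    rw [uIcc_of_le hT.le] at ht
    refine integral_congr_ae ?_
    filter_upwards [hflux t ht] with x hx
    rw [hx.2, deriv_fst_eq hφ, deriv_snd_eq hφ, sub_zero, abs_of_nonneg hx.1.1]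
    -- Here `Real.sign 0 = 0` is harmless, since the flux vanishes at density `0`; the same happens
    -- below at density `1`.
    rcases hx.1.1.eq_or_lt with h | h
    · simp [← h]
    · simp [Real.sign_of_pos h]
  have h1 : (∫ t in (0 : ℝ)..T, ∫ x,
        (|ρ t x - 1| * deriv (fun s => φ (s, x)) t +
          Real.sign (ρ t x - 1) * (ρ t x * v (ρ t x) - 1 * v 1) * deriv (fun y => φ (t, y)) x))
      = ∫ t in (0 : ℝ)..T, ((∫ x, fderiv ℝ φ (t, x) (1, 0)) -
        ∫ x, (ρ t x * fderiv ℝ φ (t, x) (1, 0)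
          + hF.compLp hF0 (ρ t) x * fderiv ℝ φ (t, x) (0, 1))) := by
    refine intervalIntegral.integral_congr fun t ht => ?_
    rw [uIcc_of_le hT.le] at ht
    rw [← integral_sub (hi3 t) (hi12 t)]
    refine integral_congr_ae ?_
    filter_upwards [hflux t ht] with x hx
    rw [hx.2, deriv_fst_eq hφ, deriv_snd_eq hφ, abs_of_nonpos (sub_nonpos.2 hx.1.2), hv.map_one]
    rcases hx.1.2.eq_or_lt with h | h
    · simp [h, hv.map_one]
    · rw [Real.sign_of_neg (sub_neg.2 h)]
      ring
  rw [h0] at e0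
  rw [h1, intervalIntegral.integral_sub hdt hJ,
    integral_integral_deriv_fst_eq_zero hφ hc hT fun z hz => (hsupp hz).1] at e1
  linarith

/-! ### Smoothed indicators of a moving strip -/

/-- The regularization, at scale `ε`, of the indicator function of `{(t, x) | α t < x < β t}`,
localized in time by `χ`. -/
noncomputable def stripTest (χ α β : ℝ → ℝ) (ε : ℝ) (z : ℝ × ℝ) : ℝ :=
  χ z.1 * (smoothStep (α z.1 + ε) ε z.2 - smoothStep (β z.1 - 2 * ε) ε z.2)

section StripTest

variable {χ α β : ℝ → ℝ} {ε s₁ s₂ : ℝ}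

lemma contDiff_stripTest (hχ : ContDiff ℝ 1 χ) (hα : ContDiff ℝ 1 α) (hβ : ContDiff ℝ 1 β) :
    ContDiff ℝ 1 (stripTest χ α β ε) := by
  have hs : ∀ γ : ℝ → ℝ, ContDiff ℝ 1 γ →
      ContDiff ℝ 1 fun z : ℝ × ℝ => smoothStep (γ z.1) ε z.2 := fun γ hγ =>
    Real.smoothTransition.contDiff.comp
      ((contDiff_snd.sub (hγ.comp contDiff_fst)).div_const ε)
  exact (hχ.comp contDiff_fst).mul ((hs (fun t => α t + ε) (hα.add contDiff_const)).sub
    (hs (fun t => β t - 2 * ε) (hβ.sub contDiff_const)))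

/-- A width of `3 * ε` gives `α + ε ≤ β - 2 * ε`, so the two steps are ordered. Nonnegativity is
needed because the weak equation comes from inequalities. -/
lemma stripTest_nonneg (hε : 0 < ε) (hχ : ∀ t, 0 ≤ χ t) (hχ0 : ∀ t ∉ Icc s₁ s₂, χ t = 0)
    (hαβ : ∀ t ∈ Icc s₁ s₂, 3 * ε ≤ β t - α t) (z : ℝ × ℝ) : 0 ≤ stripTest χ α β ε z := by
  by_cases hz : z.1 ∈ Icc s₁ s₂
  · exact mul_nonneg (hχ _) (sub_nonneg.2 (smoothStep_anti_left hε (by linarith [hαβ _ hz]) _))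
  · simp [stripTest, hχ0 _ hz]

lemma support_stripTest_subset (hε : 0 < ε) (hχ0 : ∀ t ∉ Icc s₁ s₂, χ t = 0)
    (hαβ : ∀ t ∈ Icc s₁ s₂, 3 * ε ≤ β t - α t) :
    Function.support (stripTest χ α β ε) ⊆
      {z | z.1 ∈ Icc s₁ s₂ ∧ α z.1 + ε ≤ z.2 ∧ z.2 ≤ β z.1 - ε} := by
  intro z hz
  by_contra hcon
  apply hz
  by_cases h1 : z.1 ∈ Icc s₁ s₂
  · rcases lt_or_ge z.2 (α z.1 + ε) with h2 | h2
    · rw [stripTest, smoothStep_eq_zero hε h2.le,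
        smoothStep_eq_zero hε (by linarith [hαβ _ h1]), sub_zero, mul_zero]
    · have h3 : β z.1 - ε < z.2 := by
        by_contra h3
        exact hcon ⟨h1, h2, not_lt.1 h3⟩
      rw [stripTest, smoothStep_eq_one hε (by linarith [hαβ _ h1]),
        smoothStep_eq_one hε (by linarith), sub_self, mul_zero]
  · simp [stripTest, hχ0 _ h1]

lemma tsupport_stripTest_subset (hε : 0 < ε) (hα : Continuous α) (hβ : Continuous β)
    (hχ0 : ∀ t ∉ Icc s₁ s₂, χ t = 0) (hαβ : ∀ t ∈ Icc s₁ s₂, 3 * ε ≤ β t - α t) :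
    tsupport (stripTest χ α β ε) ⊆
      {z | z.1 ∈ Icc s₁ s₂ ∧ α z.1 + ε ≤ z.2 ∧ z.2 ≤ β z.1 - ε} := by
  refine closure_minimal (support_stripTest_subset hε hχ0 hαβ) ?_
  have h1 : IsClosed {z : ℝ × ℝ | α z.1 + ε ≤ z.2} := isClosed_le (by fun_prop) (by fun_prop)
  have h2 : IsClosed {z : ℝ × ℝ | z.2 ≤ β z.1 - ε} := isClosed_le (by fun_prop) (by fun_prop)
  exact (isClosed_Icc.preimage continuous_fst).inter (h1.inter h2)

lemma hasCompactSupport_stripTest (hε : 0 < ε) (hα : Continuous α) (hβ : Continuous β)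
    (hχ0 : ∀ t ∉ Icc s₁ s₂, χ t = 0) (hαβ : ∀ t ∈ Icc s₁ s₂, 3 * ε ≤ β t - α t) :
    HasCompactSupport (stripTest χ α β ε) := by
  obtain ⟨A, hA⟩ := isCompact_Icc.exists_bound_of_continuousOn (s := Icc s₁ s₂) hα.continuousOn
  obtain ⟨B, hB⟩ := isCompact_Icc.exists_bound_of_continuousOn (s := Icc s₁ s₂) hβ.continuousOn
  refine ((isCompact_Icc (a := s₁) (b := s₂)).prod
    (isCompact_Icc (a := -A) (b := B))).of_isClosed_subset (isClosed_tsupport _)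
    ((tsupport_stripTest_subset hε hα hβ hχ0 hαβ).trans ?_)
  rintro z ⟨hz, h1, h2⟩
  refine ⟨hz, ?_, ?_⟩
  · linarith [(abs_le.1 (hA _ hz)).1]
  · linarith [(abs_le.1 (hB _ hz)).2]

lemma fderiv_stripTest_fst (hχ : ContDiff ℝ 1 χ) (hα : ContDiff ℝ 1 α) (hβ : ContDiff ℝ 1 β)
    (t x : ℝ) : fderiv ℝ (stripTest χ α β ε) (t, x) (1, 0)
      = deriv χ t * (smoothStep (α t + ε) ε x - smoothStep (β t - 2 * ε) ε x)
        + χ t * (-deriv α t * stepKernel (α t + ε) ε x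
          + deriv β t * stepKernel (β t - 2 * ε) ε x) := by
  rw [← deriv_fst_eq (contDiff_stripTest hχ hα hβ)]
  have hd : ∀ {γ : ℝ → ℝ}, ContDiff ℝ 1 γ → HasDerivAt γ (deriv γ t) t := fun h =>
    (h.differentiable one_ne_zero t).hasDerivAt
  have h := (hd hχ).mul ((hasDerivAt_smoothStep_left (ε := ε) ((hd hα).add_const ε) x).sub
    (hasDerivAt_smoothStep_left (ε := ε) ((hd hβ).sub_const (2 * ε)) x))
  refine (h.congr_deriv ?_).deriv
  simp only [Pi.sub_apply]
  ring

lemma fderiv_stripTest_snd (hχ : ContDiff ℝ 1 χ) (hα : ContDiff ℝ 1 α) (hβ : ContDiff ℝ 1 β)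
    (t x : ℝ) : fderiv ℝ (stripTest χ α β ε) (t, x) (0, 1)
      = χ t * (stepKernel (α t + ε) ε x - stepKernel (β t - 2 * ε) ε x) := by
  rw [← deriv_snd_eq (contDiff_stripTest hχ hα hβ)]
  exact (((hasDerivAt_smoothStep (c := α t + ε) (ε := ε) x).sub
    (hasDerivAt_smoothStep (c := β t - 2 * ε) (ε := ε) x)).const_mul (χ t)).deriv

lemma abs_smoothStep_sub_le {c c' : ℝ} (x : ℝ) :
    |smoothStep c ε x - smoothStep c' ε x| ≤ 1 := by
  rw [abs_le]
  constructor <;> linarith [smoothStep_nonneg (c := c) (ε := ε) x,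
    smoothStep_nonneg (c := c') (ε := ε) x, smoothStep_le_one (c := c) (ε := ε) x,
    smoothStep_le_one (c := c') (ε := ε) x]

/-- Separates the smoothed mass, weighted by `deriv χ`, from the smoothed fluxes relative to the two
moving edges. -/
lemma integral_stripTest (hε : 0 < ε) (hχ : ContDiff ℝ 1 χ) (hα : ContDiff ℝ 1 α)
    (hβ : ContDiff ℝ 1 β) (u w : Lp ℝ 1 (volume : Measure ℝ)) (t : ℝ) :
    ∫ x, (u x * fderiv ℝ (stripTest χ α β ε) (t, x) (1, 0)
      + w x * fderiv ℝ (stripTest χ α β ε) (t, x) (0, 1))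
    = deriv χ t * (∫ x, u x * (smoothStep (α t + ε) ε x - smoothStep (β t - 2 * ε) ε x))
      + χ t * (-deriv α t * (∫ x, u x * stepKernel (α t + ε) ε x)
        + deriv β t * (∫ x, u x * stepKernel (β t - 2 * ε) ε x)
        + ((∫ x, w x * stepKernel (α t + ε) ε x)
          - ∫ x, w x * stepKernel (β t - 2 * ε) ε x)) := by
  have hk : ∀ (q : Lp ℝ 1 (volume : Measure ℝ)) (c : ℝ),
      Integrable fun x => q x * stepKernel c ε x := fun q c =>
    integrable_Lp_mul_of_hasCompactSupport q continuous_stepKernel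
      (hasCompactSupport_stepKernel hε)
  have hs : Integrable fun x =>
      u x * (smoothStep (α t + ε) ε x - smoothStep (β t - 2 * ε) ε x) :=
    integrable_Lp_mul u (continuous_smoothStep.sub continuous_smoothStep)
      fun x => abs_smoothStep_sub_le x
  have h1 := (hk u (α t + ε)).const_mul (-deriv α t)
  have h2 := (hk u (β t - 2 * ε)).const_mul (deriv β t)
  have h3 := hk w (α t + ε)
  have h4 := hk w (β t - 2 * ε)
  have h12 : Integrable fun x => -deriv α t * (u x * stepKernel (α t + ε) ε x)
      + deriv β t * (u x * stepKernel (β t - 2 * ε) ε x) := h1.add h2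
  have h34 : Integrable fun x => w x * stepKernel (α t + ε) ε x
      - w x * stepKernel (β t - 2 * ε) ε x := h3.sub h4
  have h1234 : Integrable fun x => -deriv α t * (u x * stepKernel (α t + ε) ε x)
      + deriv β t * (u x * stepKernel (β t - 2 * ε) ε x) + (w x * stepKernel (α t + ε) ε x
      - w x * stepKernel (β t - 2 * ε) ε x) := h12.add h34
  rw [← integral_const_mul (-deriv α t), ← integral_const_mul (deriv β t), ← integral_add h1 h2,
    ← integral_sub h3 h4, ← integral_add h12 h34, ← integral_const_mul, ← integral_const_mul,
    ← integral_add (hs.const_mul _) (h1234.const_mul _)]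
  refine integral_congr_ae (Eventually.of_forall fun x => ?_)
  beta_reduce
  rw [fderiv_stripTest_fst hχ hα hβ, fderiv_stripTest_snd hχ hα hβ]
  ring

end StripTest

lemma tendsto_integral_smoothStep_sub {a b : ℝ} (hab : a < b) {c c' ε : ℕ → ℝ}
    (hε : ∀ m, 0 < ε m) (hca : ∀ m, a < c m) (hcb : ∀ m, c' m + ε m < b)
    (hc : Tendsto (fun m => c m + ε m) atTop (𝓝 a)) (hc' : Tendsto c' atTop (𝓝 b))
    (u : Lp ℝ 1 (volume : Measure ℝ)) :
    Tendsto (fun m => ∫ x, u x * (smoothStep (c m) (ε m) x - smoothStep (c' m) (ε m) x)) atTop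
      (𝓝 (∫ x in a..b, u x)) := by
  rw [intervalIntegral.integral_of_le hab.le, integral_Ioc_eq_integral_Ioo,
    ← integral_indicator measurableSet_Ioo]
  refine tendsto_integral_of_dominated_convergence (fun x => |u x|) (fun m => ?_)
    (L1.integrable_coeFn u).abs (fun m => Eventually.of_forall fun x => ?_)
    (Eventually.of_forall fun x => ?_)
  · exact (integrable_Lp_mul u (continuous_smoothStep.sub continuous_smoothStep)
      fun x => abs_smoothStep_sub_le x).aestronglyMeasurable
  · rw [norm_mul]
    exact mul_le_of_le_one_right (norm_nonneg _) (abs_smoothStep_sub_le x)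
  · have hcc : ∀ᶠ m in atTop, c m + ε m < c' m := hc.eventually_lt hc' hab
    refine tendsto_const_nhds.congr' ?_
    rcases le_or_gt x a with hxa | hxa
    · filter_upwards [hcc] with m hm
      rw [indicator_of_notMem fun h => h.1.not_ge hxa,
        smoothStep_eq_zero (hε m) (hxa.trans (hca m).le),
        smoothStep_eq_zero (hε m) (by linarith [hca m, hε m]), sub_zero, mul_zero]
    rcases le_or_gt b x with hxb | hxb
    · filter_upwards [hcc] with m hm
      rw [indicator_of_notMem fun h => h.2.not_ge hxb,
        smoothStep_eq_one (hε m) (by linarith [hcb m, hε m]),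
        smoothStep_eq_one (hε m) (by linarith [hcb m]), sub_self, mul_zero]
    · filter_upwards [hc.eventually_lt_const hxa, hc'.eventually_const_lt hxb] with m h1 h2
      rw [indicator_of_mem (show x ∈ Ioo a b from ⟨hxa, hxb⟩), smoothStep_eq_one (hε m) h1.le,
        smoothStep_eq_zero (hε m) h2.le, sub_zero, mul_one]

/-! ### Mass balance between two Lipschitz curves -/

/-- Conservation of mass between two Lipschitz curves with vanishing relative flux, in weak form. -/
lemma integral_deriv_mul_mass_eq_zero {T : ℝ} (hT : 0 < T)
    {ρ w : ℝ → Lp ℝ 1 (volume : Measure ℝ)} (hρ : ContinuousOn ρ (Icc 0 T))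
    (hw : ContinuousOn w (Icc 0 T)) {C : ℝ} (hρ1 : ∀ t ∈ Icc 0 T, ∀ᵐ x, |ρ t x| ≤ 1)
    (hwC : ∀ t ∈ Icc 0 T, ∀ᵐ x, |w t x| ≤ C) {K : NNReal} {a b : ℝ → ℝ} (ha : LipschitzWith K a)
    (hb : LipschitzWith K b)
    (hweak : ∀ φ : ℝ × ℝ → ℝ, ContDiff ℝ 1 φ → HasCompactSupport φ → (∀ z, 0 ≤ φ z) →
      tsupport φ ⊆ {z | z.1 ∈ Ioo 0 T ∧ z.2 ∈ Ioo (a z.1) (b z.1)} →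
      ∫ t in (0 : ℝ)..T, ∫ x, (ρ t x * fderiv ℝ φ (t, x) (1, 0)
        + w t x * fderiv ℝ φ (t, x) (0, 1)) = 0)
    (hta : ∀ᵐ t, t ∈ Ioc 0 T → ∃ r a', HasDerivAt a a' t ∧ HasRightTrace (ρ t) (a t) r ∧
      HasRightTrace (w t) (a t) (a' * r))
    (htb : ∀ᵐ t, t ∈ Ioc 0 T → ∃ r b', HasDerivAt b b' t ∧ HasLeftTrace (ρ t) (b t) r ∧
      HasLeftTrace (w t) (b t) (b' * r))
    {χ : ℝ → ℝ} (hχ : ContDiff ℝ 1 χ) (hχ0 : ∀ t, 0 ≤ χ t) {s₁ s₂ : ℝ} (hs₁ : 0 < s₁)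
    (hs₂ : s₂ < T) (hχs : ∀ t ∉ Icc s₁ s₂, χ t = 0) (hab : ∀ t ∈ Icc s₁ s₂, a t < b t) :
    ∫ t in (0 : ℝ)..T, deriv χ t * ∫ x in a t..b t, ρ t x = 0 := by
  obtain ⟨d, hd, hdab⟩ : ∃ d > 0, ∀ t ∈ Icc s₁ s₂, d ≤ b t - a t := by
    rcases (Icc s₁ s₂).eq_empty_or_nonempty with he | hne
    · exact ⟨1, one_pos, by simp [he]⟩
    · obtain ⟨t₀, ht₀, hmin⟩ := isCompact_Icc.exists_isMinOn hne
        (hb.continuous.sub ha.continuous).continuousOn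
      exact ⟨b t₀ - a t₀, sub_pos.2 (hab _ ht₀), fun t ht => hmin ht⟩
  set ε : ℕ → ℝ := fun m => 1 / ((m : ℝ) + 1) with hεdef
  have hε : ∀ m, 0 < ε m := fun m => Nat.one_div_pos_of_nat
  have hε0 : Tendsto ε atTop (𝓝 0) := tendsto_one_div_add_atTop_nhds_zero_nat
  have hK : (0 : ℝ) < 2 * (K + 1) := by positivity
  -- With this `δ` the Steklov means stay within `ε / 2` of the curves, so insetting by `ε` keeps
  -- the test function strictly inside the strip. The `+ 1` covers `K = 0`.
  set δ : ℕ → ℝ := fun m => ε m / (2 * (K + 1)) with hδdef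
  have hδ : ∀ m, 0 < δ m := fun m => div_pos (hε m) hK
  have hδ0 : Tendsto δ atTop (𝓝 0) := by simpa using hε0.div_const (2 * ((K : ℝ) + 1))
  have hKδ : ∀ m, K * δ m ≤ ε m / 2 := fun m => by
    have h1 : δ m * (2 * (K + 1)) = ε m := div_mul_cancel₀ _ hK.ne'
    nlinarith [hδ m]
  have happrox : ∀ {c : ℝ → ℝ}, LipschitzWith K c → ∀ m t,
      |steklovMean c (δ m) t - c t| ≤ ε m / 2 := fun hc m t =>
    (abs_steklovMean_sub_le hc (hδ m) t).trans (hKδ m)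
  have hsm : ∀ {c : ℝ → ℝ}, LipschitzWith K c → ∀ m, ContDiff ℝ 1 (steklovMean c (δ m)) :=
    fun hc m => contDiff_steklovMean hc.continuous _
  have hlim : ∀ {c : ℝ → ℝ}, LipschitzWith K c → ∀ t,
      Tendsto (fun m => steklovMean c (δ m) t) atTop (𝓝 (c t)) := fun hc t => by
    rw [tendsto_iff_norm_sub_tendsto_zero]
    exact squeeze_zero (fun m => norm_nonneg _) (fun m => happrox hc m t)
      (by simpa using hε0.div_const 2)
  have hderiv : ∀ {c : ℝ → ℝ}, LipschitzWith K c → ∀ m t,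
      deriv (steklovMean c (δ m)) t = (c (t + δ m) - c t) / δ m := fun hc m t =>
    (hasDerivAt_steklovMean hc.continuous _ t).deriv
  set J : ℕ → ℝ → ℝ := fun m t => ∫ x,
    (ρ t x * fderiv ℝ (stripTest χ (steklovMean a (δ m)) (steklovMean b (δ m)) (ε m)) (t, x) (1, 0)
    + w t x *
      fderiv ℝ (stripTest χ (steklovMean a (δ m)) (steklovMean b (δ m)) (ε m)) (t, x) (0, 1))
    with hJ
  have hsep : ∀ᶠ m in atTop, ∀ t ∈ Icc s₁ s₂,
      3 * ε m ≤ steklovMean b (δ m) t - steklovMean a (δ m) t := by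
    -- The two curve errors cost at most `ε` of the width `d`, which leaves the required `3 * ε`.
    have : ∀ᶠ m in atTop, 4 * ε m < d :=
      (by simpa using hε0.const_mul 4 : Tendsto (fun m => 4 * ε m) atTop (𝓝 0)).eventually_lt_const
        hd
    filter_upwards [this] with m hm t ht
    have h1 := (abs_le.1 (happrox ha m t)).2
    have h2 := (abs_le.1 (happrox hb m t)).1
    linarith [hdab t ht]
  have hJ0 : ∀ᶠ m in atTop, ∫ t in (0 : ℝ)..T, J m t = 0 := by
    filter_upwards [hsep] with m hm
    refine hweak _ (contDiff_stripTest hχ (hsm ha m) (hsm hb m))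
      (hasCompactSupport_stripTest (hε m) (hsm ha m).continuous (hsm hb m).continuous hχs hm)
      (stripTest_nonneg (hε m) hχ0 hχs hm)
      ((tsupport_stripTest_subset (hε m) (hsm ha m).continuous (hsm hb m).continuous hχs
        hm).trans ?_)
    rintro z ⟨hz, h1, h2⟩
    have h3 := (abs_le.1 (happrox ha m z.1)).1
    have h4 := (abs_le.1 (happrox hb m z.1)).2
    have := hε m
    exact ⟨⟨hs₁.trans_le hz.1, hz.2.trans_lt hs₂⟩, by linarith, by linarith⟩
  have hJmeas : ∀ᶠ m in atTop, AEStronglyMeasurable (J m) (volume.restrict (uIoc 0 T)) := by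
    filter_upwards [hsep] with m hm
    have hφ := contDiff_stripTest (ε := ε m) hχ (hsm ha m) (hsm hb m)
    have hc := hasCompactSupport_stripTest (hε m) (hsm ha m).continuous (hsm hb m).continuous
      hχs hm
    have hct := continuous_fderiv_apply' hφ (1, 0)
    have hcx := continuous_fderiv_apply' hφ (0, 1)
    obtain ⟨Ct, hCt⟩ := (hc.fderiv_apply ℝ (1, 0)).exists_bound_of_continuous hct
    obtain ⟨Cx, hCx⟩ := (hc.fderiv_apply ℝ (0, 1)).exists_bound_of_continuous hcx
    have hcont : ContinuousOn (J m) (Icc 0 T) := by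
      refine ((continuousOn_integral_Lp_mul hρ hct hCt).add
        (continuousOn_integral_Lp_mul hw hcx hCx)).congr fun t _ => ?_
      exact integral_add
        (integrable_Lp_mul (ρ t) (hct.comp (by fun_prop : Continuous fun x : ℝ => (t, x)))
          fun x => hCt (t, x))
        (integrable_Lp_mul (w t) (hcx.comp (by fun_prop : Continuous fun x : ℝ => (t, x)))
          fun x => hCx (t, x))
    rw [uIoc_of_le hT.le]
    exact (hcont.mono Ioc_subset_Icc_self).aestronglyMeasurable measurableSet_Ioc
  have hJbound : ∀ᶠ m in atTop, ∀ᵐ t, t ∈ uIoc 0 T →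
      ‖J m t‖ ≤ |deriv χ t| * ‖ρ t‖ + |χ t| * (K + K + (C + C)) := by
    refine Eventually.of_forall fun m => Eventually.of_forall fun t ht => ?_
    rw [uIoc_of_le hT.le] at ht
    have htI := Ioc_subset_Icc_self ht
    rw [hJ]
    beta_reduce
    rw [integral_stripTest (hε m) hχ (hsm ha m) (hsm hb m), hderiv ha, hderiv hb]
    refine (norm_add_le _ _).trans (add_le_add ?_ ?_)
    · rw [norm_mul]
      refine mul_le_mul_of_nonneg_left ?_ (norm_nonneg _)
      simpa using abs_integral_Lp_mul_le (C := 1) (ρ t)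
        fun x => abs_smoothStep_sub_le (ε := ε m) x
    · rw [norm_mul]
      refine mul_le_mul_of_nonneg_left ?_ (norm_nonneg _)
      have hka : ∀ {c : ℝ → ℝ}, LipschitzWith K c → ∀ y : ℝ,
          ‖(c (t + δ m) - c t) / δ m * ∫ x, ρ t x * stepKernel y (ε m) x‖ ≤ K := by
        intro c hc y
        rw [norm_mul]
        calc _ ≤ (K : ℝ) * 1 := mul_le_mul (abs_slope_le hc (hδ m) t)
              (abs_integral_mul_stepKernel_le (hε m) (hρ1 t htI)) (abs_nonneg _) K.2
          _ = K := mul_one _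
      refine (norm_add_le _ _).trans (add_le_add ((norm_add_le _ _).trans
        (add_le_add ?_ (hka hb _))) ((norm_sub_le _ _).trans (add_le_add
        (abs_integral_mul_stepKernel_le (hε m) (hwC t htI))
        (abs_integral_mul_stepKernel_le (hε m) (hwC t htI)))))
      rw [neg_mul, norm_neg]
      exact hka ha _
  have hbound : IntervalIntegrable
      (fun t => |deriv χ t| * ‖ρ t‖ + |χ t| * (K + K + (C + C))) volume 0 T := by
    refine ContinuousOn.intervalIntegrable ?_
    rw [uIcc_of_le hT.le]
    have h1 : Continuous (deriv χ) := hχ.continuous_deriv le_rfl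
    have h2 := hχ.continuous
    exact (h1.abs.continuousOn.mul hρ.norm).add (h2.abs.mul continuous_const).continuousOn
  have hJlim : ∀ᵐ t, t ∈ uIoc 0 T →
      Tendsto (fun m => J m t) atTop (𝓝 (deriv χ t * ∫ x in a t..b t, ρ t x)) := by
    filter_upwards [hta, htb] with t h1 h2 ht
    rw [uIoc_of_le hT.le] at ht
    obtain ⟨r, a', haa, hra, hwa⟩ := h1 ht
    obtain ⟨q, b', hbb, hqb, hwb⟩ := h2 ht
    simp only [hJ, integral_stripTest (hε _) hχ (hsm ha _) (hsm hb _), hderiv ha, hderiv hb]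
    by_cases hts : t ∈ Icc s₁ s₂
    · have hca : ∀ m, a t < steklovMean a (δ m) t + ε m := fun m => by
        linarith [(abs_le.1 (happrox ha m t)).1, hε m]
      have hcb : ∀ m, steklovMean b (δ m) t - 2 * ε m + ε m < b t := fun m => by
        linarith [(abs_le.1 (happrox hb m t)).2, hε m]
      have hlima : Tendsto (fun m => steklovMean a (δ m) t + ε m + ε m) atTop (𝓝 (a t)) := by
        simpa using ((hlim ha t).add hε0).add hε0
      have hlimb : Tendsto (fun m => steklovMean b (δ m) t - 2 * ε m) atTop (𝓝 (b t)) := by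
        simpa using (hlim hb t).sub (hε0.const_mul 2)
      have hia := tendsto_Icc_smallSets_nhdsGT hca hlima
      have hib := tendsto_Icc_smallSets_nhdsLT hcb hlimb
      have hk : ∀ (u : Lp ℝ 1 (volume : Measure ℝ)) (c : ℕ → ℝ) m,
          Integrable fun x => u x * stepKernel (c m) (ε m) x := fun u c m =>
        integrable_Lp_mul_of_hasCompactSupport u continuous_stepKernel
          (hasCompactSupport_stepKernel (hε m))
      have hmass := tendsto_integral_smoothStep_sub (hab t hts) hε hca hcb hlima hlimb (ρ t)
      have hfin := (hmass.const_mul (deriv χ t)).add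
        (((((tendsto_slope haa hδ hδ0).neg.mul
          (tendsto_integral_mul_stepKernel hε hia hra (hk _ _))).add
          ((tendsto_slope hbb hδ hδ0).mul
          (tendsto_integral_mul_stepKernel hε hib hqb (hk _ _)))).add
          ((tendsto_integral_mul_stepKernel hε hia hwa (hk _ _)).sub
          (tendsto_integral_mul_stepKernel hε hib hwb (hk _ _)))).const_mul (χ t))
      -- The edge terms cancel exactly because each flux trace is the curve's speed times the
      -- density trace.
      have hz : deriv χ t * (∫ x in a t..b t, ρ t x)
          + χ t * (-a' * r + b' * q + (a' * r - b' * q))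
          = deriv χ t * (∫ x in a t..b t, ρ t x) := by ring
      rwa [hz] at hfin
    · have hd0 : deriv χ t = 0 := by
        have : χ =ᶠ[𝓝 t] fun _ => 0 := by
          filter_upwards [isClosed_Icc.isOpen_compl.mem_nhds hts] with s hs using hχs s hs
        rw [this.deriv_eq, deriv_const]
      simp [hd0, hχs t hts]
  have hconv := intervalIntegral.tendsto_integral_filter_of_dominated_convergence _ hJmeas hJbound
    hbound hJlim
  exact tendsto_nhds_unique hconv (tendsto_const_nhds.congr' (hJ0.mono fun m hm => hm.symm))

/-- A continuous function with vanishing weak derivative is locally constant. -/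
lemma eventually_eq_of_integral_deriv_mul_eq_zero {T t₀ : ℝ} (ht₀ : t₀ ∈ Ioo 0 T) {M : ℝ → ℝ}
    (hM : ContinuousOn M (Icc 0 T)) {U : Set ℝ} (hU : U ∈ 𝓝 t₀)
    (h : ∀ χ : ℝ → ℝ, ContDiff ℝ 1 χ → (∀ t, 0 ≤ χ t) → ∀ s₁ s₂, 0 < s₁ → s₂ < T →
      Icc s₁ s₂ ⊆ U → (∀ t ∉ Icc s₁ s₂, χ t = 0) →
      ∫ t in (0 : ℝ)..T, deriv χ t * M t = 0) :
    ∀ᶠ s in 𝓝 t₀, M s = M t₀ := by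
  have key : ∀ s₁ s₂, 0 < s₁ → s₁ < s₂ → s₂ < T → Icc s₁ s₂ ⊆ U → M s₁ = M s₂ := by
    intro s₁ s₂ h0 h12 h2T hsub
    -- The test function is a plateau rising on `[s₁, s₁ + ε]` and falling on `[s₂ - ε, s₂]`. Its
    -- derivative is a difference of two kernels, whose limits against `M` are `M s₁` and `M s₂`; `ε
    -- ≤ (s₂ - s₁) / 2` keeps it nonnegative.
    set ε : ℕ → ℝ := fun m => (s₂ - s₁) / 2 / ((m : ℝ) + 1) with hεdef
    have hε : ∀ m, 0 < ε m := fun m => by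
      have := sub_pos.2 h12
      positivity
    have hε0 : Tendsto ε atTop (𝓝 0) := by
      simpa [hεdef, div_eq_mul_inv] using
        tendsto_one_div_add_atTop_nhds_zero_nat (𝕜 := ℝ) |>.const_mul ((s₂ - s₁) / 2)
    have hεle : ∀ m, ε m ≤ (s₂ - s₁) / 2 := fun m =>
      div_le_self (by linarith) (by linarith [(Nat.cast_nonneg m : (0 : ℝ) ≤ m)])
    set g : ℝ → ℝ := (Icc 0 T).indicator M
    have hgi : Integrable g :=
      (integrable_indicator_iff measurableSet_Icc).2 (hM.integrableOn_compact isCompact_Icc)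
    have hk : ∀ (c : ℕ → ℝ) m, Integrable fun x => g x * stepKernel (c m) (ε m) x := by
      intro c m
      obtain ⟨C, hC⟩ := (hasCompactSupport_stepKernel (c := c m)
        (hε m)).exists_bound_of_continuous continuous_stepKernel
      exact hgi.mul_bdd continuous_stepKernel.aestronglyMeasurable (Eventually.of_forall hC)
    have hgc : ∀ s ∈ Ioo 0 T, Tendsto g (𝓝 s) (𝓝 (M s)) := fun s hs =>
      ((hM s (Ioo_subset_Icc_self hs)).continuousAt (Icc_mem_nhds hs.1 hs.2)).tendsto.congr' (by
        filter_upwards [Icc_mem_nhds hs.1 hs.2] with x hx using (indicator_of_mem hx M).symm)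
    have l1 := tendsto_integral_mul_stepKernel (l := 𝓝[≥] s₁) (c := fun _ => s₁) hε (by
      rw [tendsto_smallSets_iff]
      intro V hV
      obtain ⟨y, hy, hyV⟩ := mem_nhdsGE_iff_exists_Ico_subset.1 hV
      have : Tendsto (fun m => s₁ + ε m) atTop (𝓝 s₁) := by simpa using hε0.const_add s₁
      filter_upwards [this.eventually_lt_const (mem_Ioi.1 hy)] with m hm x hx
      exact hyV ⟨hx.1, hx.2.trans_lt hm⟩)
      ((hgc s₁ ⟨h0, h12.trans h2T⟩).mono_left (inf_le_left.trans inf_le_left)) (hk _)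
    have l2 := tendsto_integral_mul_stepKernel (l := 𝓝[≤] s₂) (c := fun m => s₂ - ε m) hε (by
      rw [tendsto_smallSets_iff]
      intro V hV
      obtain ⟨y, hy, hyV⟩ := mem_nhdsLE_iff_exists_Ioc_subset.1 hV
      have : Tendsto (fun m => s₂ - ε m) atTop (𝓝 s₂) := by simpa using hε0.const_sub s₂
      filter_upwards [this.eventually_const_lt (mem_Iio.1 hy)] with m hm x hx
      exact hyV ⟨hm.trans_le hx.1, by linarith [hx.2]⟩)
      ((hgc s₂ ⟨h0.trans h12, h2T⟩).mono_left (inf_le_left.trans inf_le_left)) (hk _)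
    have hz : ∀ m, (∫ x, g x * stepKernel s₁ (ε m) x)
        - ∫ x, g x * stepKernel (s₂ - ε m) (ε m) x = 0 := by
      intro m
      rw [← integral_sub (hk (fun _ => s₁) m) (hk (fun m => s₂ - ε m) m)]
      have hχ := h (fun t => smoothStep s₁ (ε m) t - smoothStep (s₂ - ε m) (ε m) t)
        ((Real.smoothTransition.contDiff.comp ((contDiff_id.sub contDiff_const).div_const _)).sub
          (Real.smoothTransition.contDiff.comp ((contDiff_id.sub contDiff_const).div_const _)))
        (fun t => sub_nonneg.2 (smoothStep_anti_left (hε m) (by linarith [hεle m]) t))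
        s₁ s₂ h0 h2T hsub (fun t ht => by
          rcases lt_or_ge t s₁ with h1 | h1
          · rw [smoothStep_eq_zero (hε m) h1.le,
              smoothStep_eq_zero (hε m) (by linarith [hεle m]), sub_zero]
          · have h2 : s₂ < t := by
              by_contra h2
              exact ht ⟨h1, not_lt.1 h2⟩
            rw [smoothStep_eq_one (hε m) (by linarith [hεle m]),
              smoothStep_eq_one (hε m) (by linarith), sub_self])
      rw [intervalIntegral.integral_of_le (by linarith), ← integral_Icc_eq_integral_Ioc,
        ← integral_indicator measurableSet_Icc] at hχ
      rw [← hχ]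
      refine integral_congr_ae (Eventually.of_forall fun t => ?_)
      have hd : deriv (fun t => smoothStep s₁ (ε m) t - smoothStep (s₂ - ε m) (ε m) t) t
          = stepKernel s₁ (ε m) t - stepKernel (s₂ - ε m) (ε m) t :=
        ((hasDerivAt_smoothStep t).sub (hasDerivAt_smoothStep t)).deriv
      by_cases ht : t ∈ Icc 0 T
      · simp only [g, indicator_of_mem ht, hd]
        ring
      · simp [g, indicator_of_notMem ht]
    have := tendsto_nhds_unique (l1.sub l2) (tendsto_const_nhds.congr fun m => (hz m).symm)
    linarith
  obtain ⟨u₁, u₂, hu, hsub⟩ := mem_nhds_iff_exists_Ioo_subset.1 hU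
  filter_upwards [Ioo_mem_nhds hu.1 hu.2, Ioo_mem_nhds ht₀.1 ht₀.2] with s hs hs'
  rcases lt_trichotomy s t₀ with hlt | rfl | hgt
  · exact key s t₀ hs'.1 hlt ht₀.2 fun x hx =>
      hsub ⟨hs.1.trans_le hx.1, hx.2.trans_lt hu.2⟩
  · rfl
  · exact (key t₀ s ht₀.1 hgt hs'.2 fun x hx =>
      hsub ⟨hu.1.trans_le hx.1, hx.2.trans_lt hs.2⟩).symm

lemma Ioo_subset_macroRegion {N : ℕ} {n : ℕ → ℕ} {q : ℕ → ℕ → ℝ} {j : ℕ} (h1 : 1 ≤ j)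
    (h2 : j < N) : Ioo (q j (n j)) (q (j + 1) 1) ⊆ macroRegion N n q := fun _ hx =>
  Or.inl (Or.inr (mem_iUnion₂.2 ⟨j, ⟨h1, h2⟩, hx⟩))

lemma hasDerivAt_of_eqOn_Icc {a a₁ : ℝ → ℝ} {T t d : ℝ} (h : EqOn a a₁ (Icc 0 T))
    (ht : t ∈ Ioo 0 T) (hd : HasDerivAt a d t) : HasDerivAt a₁ d t :=
  hd.congr_of_eventuallyEq (by
    filter_upwards [Icc_mem_nhds ht.1 ht.2] with s hs using (h hs).symm)

/-! ### Vanishing relative flux and local conservation for solutions -/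

section Solution

variable {v : ℝ → ℝ} {ℓ : ℝ} {N : ℕ} {n : ℕ → ℕ} {ρ₀ : Lp ℝ 1 (volume : Measure ℝ)}
  {p₀ : ℕ → ℕ → ℝ} {T : ℝ} {ρ : ℝ → Lp ℝ 1 (volume : Measure ℝ)} {p : ℕ → ℕ → ℝ → ℝ}

/-- No mass flows through the trajectory of a leader. -/
lemma IsSolution.leader_flux (hsol : IsSolution v ℓ N n ρ₀ p₀ T ρ p) {j : ℕ} (h1 : 1 ≤ j)
    (h2 : j ≤ N) : ∀ᵐ t, t ∈ Icc 0 T → ∃ r ∈ Icc (0 : ℝ) 1, ∃ a', HasDerivAt (p j (n j)) a' t ∧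
      HasRightTrace (ρ t) (p j (n j) t) r ∧ r * v r = a' * r := by
  filter_upwards [hsol.leader j h1 h2] with t h ht
  obtain ⟨r, hr, hd⟩ := h ht
  have := neBot_nhdsGT_inf_ae (p j (n j) t)
  exact ⟨r, mem_Icc_of_tendsto_inf_ae (hsol.density t ht).mem_Icc hr, _, hd, hr, mul_comm _ _⟩

/-- No mass flows through the trajectory of the last vehicle of a group. -/
lemma IsSolution.tail_flux (hsol : IsSolution v ℓ N n ρ₀ p₀ T ρ p) (hv : SpeedLaw v) (hℓ : 0 < ℓ)
    {j : ℕ} (h1 : 1 ≤ j) (h2 : j ≤ N) (hn : 2 ≤ n j) : ∀ᵐ t, t ∈ Icc 0 T →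
      ∃ r ∈ Icc (0 : ℝ) 1, ∃ b', HasDerivAt (p j 1) b' t ∧
        HasLeftTrace (ρ t) (p j 1 t) r ∧ r * v r = b' * r := by
  filter_upwards [hsol.tail j h1 h2, hsol.follower j h1 h2 1 le_rfl hn] with t h h' ht
  obtain ⟨r, s, hr, hd, hsol'⟩ := h ht
  have := neBot_nhdsLT_inf_ae (p j 1 t)
  have hr1 := mem_Icc_of_tendsto_inf_ae (hsol.density t ht).mem_Icc hr
  have hs : s = v (ℓ / (p j 2 t - p j 1 t)) := hd.unique (h' ht)
  have hgap : ℓ ≤ p j 2 t - p j 1 t :=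
    (hsol.positions t ht).mem_positionSet j h1 h2 1 le_rfl hn
  have hgap0 := hℓ.trans_le hgap
  refine ⟨r, hr1, s, hd, hr, ?_⟩
  rw [hs]
  refine hv.flux_eq_of_riemannSolution_eq hr1 (div_pos hℓ hgap0) ((div_le_one hgap0).2 hgap)
    fun ξ hξ => ?_
  -- By self-similarity, one unit of time after `t` the position relative to the tail is the speed
  -- `ξ`.
  have := hsol' (t + 1) (p j 1 t + ξ) (by linarith) (by rw [hs]; linarith)
  simpa using this

/-- The mass between two consecutive groups is locally constant in time as long as the groups do not
touch. -/
lemma IsSolution.eventually_mass_eq (hsol : IsSolution v ℓ N n ρ₀ p₀ T ρ p) (hv : SpeedLaw v)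
    (hℓ : 0 < ℓ) (hn : ∀ j, 1 ≤ j → j ≤ N → 2 ≤ n j) (hT : 0 < T) {j : ℕ} (h1 : 1 ≤ j)
    (h2 : j < N) {K : NNReal} {a b : ℝ → ℝ} (ha : LipschitzWith K a) (hb : LipschitzWith K b)
    (hpa : EqOn (p j (n j)) a (Icc 0 T)) (hpb : EqOn (p (j + 1) 1) b (Icc 0 T)) {t₀ : ℝ}
    (ht₀ : t₀ ∈ Ioo 0 T) (hab : a t₀ < b t₀) :
    ∀ᶠ s in 𝓝 t₀, ∫ x in a s..b s, ρ s x = ∫ x in a t₀..b t₀, ρ t₀ x := by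
  obtain ⟨L, F, hF, hF0, hFv⟩ := hv.exists_lipschitz_flux
  have hρ1 : ∀ t ∈ Icc 0 T, ∀ᵐ x, |ρ t x| ≤ 1 := fun t ht => by
    filter_upwards [(hsol.density t ht).mem_Icc] with x hx
    rw [abs_of_nonneg hx.1]
    exact hx.2
  have hwC : ∀ t ∈ Icc 0 T, ∀ᵐ x, |hF.compLp hF0 (ρ t) x| ≤ L := fun t ht => by
    filter_upwards [hρ1 t ht, hF.coeFn_compLp hF0 (ρ t)] with x hx hx'
    have h := hF.dist_le_mul (ρ t x) 0
    rw [hF0, dist_zero_right, dist_zero_right, Real.norm_eq_abs, Real.norm_eq_abs] at h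
    rw [hx', Function.comp_apply]
    exact h.trans (mul_le_of_le_one_right L.2 hx)
  have htrace : ∀ t {l : Filter ℝ} {r}, r ∈ Icc (0 : ℝ) 1 →
      Tendsto (ρ t) (l ⊓ ae volume) (𝓝 r) →
      Tendsto (hF.compLp hF0 (ρ t)) (l ⊓ ae volume) (𝓝 (r * v r)) := by
    intro t l r hr h
    rw [← hFv r hr]
    exact ((hF.continuous.tendsto r).comp h).congr'
      ((hF.coeFn_compLp hF0 (ρ t)).symm.filter_mono inf_le_right)
  -- The extended curves agree with the trajectories only on `[0, T]`, so derivatives transfer at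
  -- interior times; `t = T` is discarded as a null set.
  have hne : ∀ᵐ t : ℝ, t ≠ T := by simp [ae_iff]
  refine eventually_eq_of_integral_deriv_mul_eq_zero ht₀
    (continuousOn_intervalIntegral_Lp hsol.continuousOn ha.continuous.continuousOn
      hb.continuous.continuousOn)
    ((isOpen_lt ha.continuous hb.continuous).mem_nhds hab)
    fun χ hχ hχ0 s₁ s₂ hs₁ hs₂ hsub hχs => ?_
  refine integral_deriv_mul_mass_eq_zero hT hsol.continuousOn
    ((hF.continuous_compLp hF0).comp_continuousOn hsol.continuousOn) hρ1 hwC ha hb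
    (fun φ hφ hc hpos hsupp => hsol.weak hv hT hF hF0 hFv hφ hc hpos fun z hz => ?_)
    ?_ ?_ hχ hχ0 hs₁ hs₂ hχs hsub
  · obtain ⟨hzt, hzx⟩ := hsupp hz
    refine ⟨hzt, Ioo_subset_macroRegion h1 h2 ?_⟩
    rwa [hpa (Ioo_subset_Icc_self hzt), hpb (Ioo_subset_Icc_self hzt)]
  · filter_upwards [hsol.leader_flux h1 h2.le, hne] with t h hneT ht
    obtain ⟨r, hr, a', hd, htr, hfl⟩ := h (Ioc_subset_Icc_self ht)
    rw [hpa (Ioc_subset_Icc_self ht)] at htr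
    exact ⟨r, a', hasDerivAt_of_eqOn_Icc hpa ⟨ht.1, ht.2.lt_of_ne hneT⟩ hd, htr,
      hfl ▸ htrace t hr htr⟩
  · filter_upwards [hsol.tail_flux hv hℓ (Nat.le_add_left 1 j) h2 (hn _ (Nat.le_add_left 1 j) h2),
      hne] with t h hneT ht
    obtain ⟨r, hr, b', hd, htr, hfl⟩ := h (Ioc_subset_Icc_self ht)
    rw [hpb (Ioc_subset_Icc_self ht)] at htr
    exact ⟨r, b', hasDerivAt_of_eqOn_Icc hpb ⟨ht.1, ht.2.lt_of_ne hneT⟩ hd, htr,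
      hfl ▸ htrace t hr htr⟩

end Solution

end MicroMacro

theorem proposition2p4 (v : ℝ → ℝ) (hv : MicroMacro.SpeedLaw v) (ℓ : ℝ) (hℓ : 0 < ℓ)
    (N : ℕ) (hN : 1 ≤ N) (n : ℕ → ℕ) (hn : ∀ j, 1 ≤ j → j ≤ N → 2 ≤ n j)
    (ρ₀ : Lp ℝ 1 (volume : Measure ℝ)) (p₀ : ℕ → ℕ → ℝ)
    (h₀ : MicroMacro.AdmissibleData ℓ N n ρ₀ p₀) (T : ℝ) (hT : 0 < T)
    (ρ : ℝ → Lp ℝ 1 (volume : Measure ℝ)) (p : ℕ → ℕ → ℝ → ℝ)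
    (hsol : MicroMacro.IsSolution v ℓ N n ρ₀ p₀ T ρ p) :
    ∀ t ∈ Icc 0 T, ∀ j, 1 ≤ j → j < N →
      ∫ x in (p j (n j) t)..(p (j + 1) 1 t), ρ t x =
        ∫ x in (p₀ j (n j))..(p₀ (j + 1) 1), ρ₀ x := by
  intro t ht j h1 h2
  have hj1 : 1 ≤ j + 1 := Nat.le_add_left 1 j
  have hnj : 1 ≤ n j := one_le_two.trans (hn j h1 h2.le)
  have hnj1 : 1 ≤ n (j + 1) := one_le_two.trans (hn (j + 1) hj1 h2)
  obtain ⟨K₁, hK₁⟩ := hsol.lipschitz j h1 h2.le (n j) hnj le_rfl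
  obtain ⟨K₂, hK₂⟩ := hsol.lipschitz (j + 1) hj1 h2 1 le_rfl hnj1
  obtain ⟨a, ha, hpa⟩ := hK₁.extend_real
  obtain ⟨b, hb, hpb⟩ := hK₂.extend_real
  have ha' := ha.weaken (le_max_left K₁ K₂)
  have hb' := hb.weaken (le_max_right K₁ K₂)
  have hle : ∀ s ∈ Icc 0 T, a s ≤ b s := fun s hs => by
    rw [← hpa hs, ← hpb hs]
    exact (hsol.positions s hs).ordered j h1 h2
  have h0T : (0 : ℝ) ∈ Icc 0 T := left_mem_Icc.2 hT.le
  have hconst := MicroMacro.eqOn_const_of_locally_const (M := fun s => ∫ x in a s..b s, ρ s x) hT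
    (MicroMacro.continuousOn_intervalIntegral_Lp hsol.continuousOn ha.continuous.continuousOn
      hb.continuous.continuousOn) (fun s hs hne => by
      refine hsol.eventually_mass_eq hv hℓ hn hT h1 h2 ha' hb' hpa hpb hs
        -- Equal endpoints would make the integral zero, so nonzero mass forces the groups apart.
        ((hle s (Ioo_subset_Icc_self hs)).lt_of_ne fun h => hne ?_)
      simp [h]) t ht
  beta_reduce at hconst
  rw [hpa ht, hpb ht, hconst, ← hpa h0T, ← hpb h0T,
    hsol.initial_positions j h1 h2.le (n j) hnj le_rfl,
    hsol.initial_positions (j + 1) hj1 h2 1 le_rfl hnj1]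
  have hle0 := h₀.positions.ordered j h1 h2
  -- The initial densities are known to agree only on the open macroscopic region, hence the passage
  -- to open intervals.
  rw [intervalIntegral.integral_of_le hle0, intervalIntegral.integral_of_le hle0,
    integral_Ioc_eq_integral_Ioo, integral_Ioc_eq_integral_Ioo]
  refine setIntegral_congr_ae measurableSet_Ioo ?_
  filter_upwards [hsol.initial_density] with x hx hxI
  exact hx (MicroMacro.Ioo_subset_macroRegion h1 h2 hxI)
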